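/- Let $\ell,n,m\ge 1$ and $\zeta,v_1,\dots,v_\ell\in\mathbb{C}^\times$. For $k\ge 0$ let $\mathbf{H}(\Gamma_k)$ be the cyclotomic Hecke algebra: the $\mathbb{C}$-algebra generated by $X_1,\dots,X_k,T_1,\dots,T_{k-1}$ with the relations $$X_iX_j=X_jX_i,\qquad T_iX_j=X_jT_i\ (j\ne i,i+1),\qquad T_iX_iT_i=\zeta X_{i+1},\qquad (T_i+1)(T_i-\zeta)=0,$$ $$T_iT_j=T_jT_i\ (|i-j|\ge 2),\qquad T_iT_{i+1}T_i=T_{i+1}T_iT_{i+1},\qquad (X_1-v_1)\cdots(X_1-v_\ell)=0\ \ (\text{the last one if } k\ge 1).$$ Put $N=n+m$ and $T_0=X_1$. For $I\subset\{0,1,\dots,N-1\}$ let $\mathbf{H}(\Gamma_I)\subset\mathbf{H}(\Gamma_N)$ be the subalgebra generated by the $T_i$, $i\in I$, and for $a+b\le N$ let $\mathbf{H}(\Gamma_{a,b})=\mathbf{H}(\Gamma_I)$ with $I=\{0,\dots,a+b-1\}\setminus\{a\}$. For $1\le i\le j\le N$ let $T_{i,j}=T_iT_{i+1}\cdots T_{j-2}\,T_{j-1}\,T_{j-2}\cdots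 T_{i+1}T_i$ (so $T_{j,j}=1$); this is the product of the $T$'s along a reduced expression of the transposition $(i,j)$. For subalgebras $P,Q$ and an element $h$, let $PhQ$ be the linear span of the products $xhy$, $x\in P$, $y\in Q$. The assignment $X_i\mapsto X_i$, $T_i\mapsto T_i$ identifies $\mathbf{H}(\Gamma_{N-1})$ with the subalgebra $\mathbf{H}(\Gamma_{\{0,\dots,N-2\}})$ of $\mathbf{H}(\Gamma_N)$, and with this identification the following hold. (a) $\mathbf{H}(\Gamma_N)$ is a free left $\mathbf{H}(\Gamma_{N-1})$-module with basis $T_{j,N}X_j^p$, $1\le j\le N$, $0\le p<\ell$; that is, $$\mathbf{H}(\Gamma_N)=\bigoplus_{0\le p<\ell}\ \bigoplus_{1\le j\le N}\mathbf{H}(\Gamma_{N-1})\,T_{j,N}X_j^p,$$ each summand being free of rank one on its generator. (b) As an $(\mathbf{H}(\Gamma_{N-1}),\mathbf{H}(\Gamma_{n,m}))$-bimodule, $\mathbf{H}(\Gamma_N)$ is the direct sum $$\mathbf{H}(\Gamma_N)=\mathbf{H}(\Gamma_{N-1})\,T_{n,N}\,\mathbf{H}(\Gamma_{n,m})\ \oplus\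 \bigoplus_{0\le p<\ell}\mathbf{H}(\Gamma_{N-1})\,X_N^p\,\mathbf{H}(\Gamma_{n,m}).$$ (c) There is an algebra isomorphism $\varphi:\mathbf{H}(\Gamma_{n-1,m})\to\mathbf{H}(\Gamma_{I})$, $I=\{0,\dots,N-1\}\setminus\{n-1,n\}$, with $\varphi(X_i)=X_i$ for $1\le i<n$, $\varphi(T_i)=T_i$ for $0\le i<n-1$ and $\varphi(T_i)=T_{i+1}$ for $n\le i<N-1$ (these values determine $\varphi$). There are isomorphisms of $(\mathbf{H}(\Gamma_{N-1}),\mathbf{H}(\Gamma_{n,m}))$-bimodules $$\mathbf{H}(\Gamma_{N-1})\,T_{n,N}\,\mathbf{H}(\Gamma_{n,m})\cong\mathbf{H}(\Gamma_{N-1})\otimes_{\mathbf{H}(\Gamma_{n-1,m})}\mathbf{H}(\Gamma_{n,m}),$$ $$\mathbf{H}(\Gamma_{N-1})\,X_N^p\,\mathbf{H}(\Gamma_{n,m})\cong\mathbf{H}(\Gamma_{N-1})\otimes_{\mathbf{H}(\Gamma_{n,m-1})}\mathbf{H}(\Gamma_{n,m})\qquad(0\le p<\ell).$$ In the first one $\mathbf{H}(\Gamma_{n-1,m})$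 acts on $\mathbf{H}(\Gamma_{N-1})$ through the inclusion and on $\mathbf{H}(\Gamma_{n,m})$ through $\varphi$ and the inclusion $\mathbf{H}(\Gamma_I)\subset\mathbf{H}(\Gamma_{n,m})$; in the second one $\mathbf{H}(\Gamma_{n,m-1})$ acts through the inclusions. -/

import Mathlib

open scoped TensorProduct

/-! ### Affine and cyclotomic Hecke algebras -/

/-- The generators `X_1, …, X_n` and `T_1, …, T_{n-1}`. -/
inductive AffineHeckeGen (n : ℕ) : Type
  | X (i : ℕ) (hi : 1 ≤ i ∧ i ≤ n) : AffineHeckeGen n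
  | T (i : ℕ) (hi : 1 ≤ i ∧ i < n) : AffineHeckeGen n

namespace AffineHeckeGen

/-- The generator `X_i` in the free algebra. -/
noncomputable def x {n : ℕ} (i : ℕ) (hi : 1 ≤ i ∧ i ≤ n) : FreeAlgebra ℂ (AffineHeckeGen n) :=
  FreeAlgebra.ι ℂ (X i hi)

/-- The generator `T_i` in the free algebra. -/
noncomputable def t {n : ℕ} (i : ℕ) (hi : 1 ≤ i ∧ i < n) : FreeAlgebra ℂ (AffineHeckeGen n) :=
  FreeAlgebra.ι ℂ (T i hi)

end AffineHeckeGen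

open AffineHeckeGen in
/-- The defining relations of the affine Hecke algebra of type `GL_n` with parameter `ζ`. -/
inductive AffineHeckeRel (ζ : ℂ) (n : ℕ) :
    FreeAlgebra ℂ (AffineHeckeGen n) → FreeAlgebra ℂ (AffineHeckeGen n) → Prop
  | x_comm (i j : ℕ) (hi : 1 ≤ i ∧ i ≤ n) (hj : 1 ≤ j ∧ j ≤ n) :
      AffineHeckeRel ζ n (x i hi * x j hj) (x j hj * x i hi)
  | t_x_comm (i j : ℕ) (hi : 1 ≤ i ∧ i < n) (hj : 1 ≤ j ∧ j ≤ n) (hij : j ≠ i) (hij' : j ≠ i + 1) :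
      AffineHeckeRel ζ n (t i hi * x j hj) (x j hj * t i hi)
  | t_x_t (i : ℕ) (hi : 1 ≤ i ∧ i < n) :
      AffineHeckeRel ζ n (t i hi * x i ⟨hi.1, hi.2.le⟩ * t i hi)
        (ζ • x (i + 1) ⟨Nat.le_add_left 1 i, hi.2⟩)
  | quadratic (i : ℕ) (hi : 1 ≤ i ∧ i < n) :
      AffineHeckeRel ζ n ((t i hi + 1) * (t i hi - algebraMap ℂ _ ζ)) 0
  | t_comm (i j : ℕ) (hi : 1 ≤ i ∧ i < n) (hj : 1 ≤ j ∧ j < n) (hij : i + 1 < j ∨ j + 1 < i) :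
      AffineHeckeRel ζ n (t i hi * t j hj) (t j hj * t i hi)
  | braid (i : ℕ) (hi : 1 ≤ i ∧ i < n) (hi' : 1 ≤ i + 1 ∧ i + 1 < n) :
      AffineHeckeRel ζ n (t i hi * t (i + 1) hi' * t i hi) (t (i + 1) hi' * t i hi * t (i + 1) hi')

/-- The affine Hecke algebra, generated by the `X_i` and the `T_i`. (Inverses of the `X_i` are not
adjoined here: in the cyclotomic quotients below the `X_i` are invertible anyway, because the
parameters `ζ`, `v_p` are nonzero.) -/
def AffineHecke (ζ : ℂ) (n : ℕ) : Type := RingQuot (AffineHeckeRel ζ n)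

namespace AffineHecke

noncomputable instance (ζ : ℂ) (n : ℕ) : Ring (AffineHecke ζ n) :=
  inferInstanceAs (Ring (RingQuot (AffineHeckeRel ζ n)))

noncomputable instance (ζ : ℂ) (n : ℕ) : Algebra ℂ (AffineHecke ζ n) :=
  inferInstanceAs (Algebra ℂ (RingQuot (AffineHeckeRel ζ n)))

/-- The quotient map from the free algebra. -/
noncomputable def mk (ζ : ℂ) (n : ℕ) : FreeAlgebra ℂ (AffineHeckeGen n) →ₐ[ℂ] AffineHecke ζ n :=
  RingQuot.mkAlgHom ℂ (AffineHeckeRel ζ n)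

end AffineHecke

/-- The relation `(X_1 - v_1)(X_1 - v_2)⋯(X_1 - v_ℓ) = 0`. (If `n = 0` there is no `X_1` and no
relation.) -/
inductive CyclotomicRel (ζ : ℂ) {ℓ : ℕ} (v : Fin ℓ → ℂ) (n : ℕ) :
    AffineHecke ζ n → AffineHecke ζ n → Prop
  | mk (h : 1 ≤ 1 ∧ 1 ≤ n) : CyclotomicRel ζ v n
      (List.ofFn fun p : Fin ℓ =>
        AffineHecke.mk ζ n (AffineHeckeGen.x 1 h) - algebraMap ℂ _ (v p)).prod 0

/-- The cyclotomic Hecke algebra `H(Γ_n)` with parameters `ζ, v_1, …, v_ℓ`: the quotient of the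
affine Hecke algebra by the two-sided ideal generated by `(X_1 - v_1)⋯(X_1 - v_ℓ)`. -/
def CyclotomicHecke (ζ : ℂ) {ℓ : ℕ} (v : Fin ℓ → ℂ) (n : ℕ) : Type := RingQuot (CyclotomicRel ζ v n)

namespace CyclotomicHecke

variable (ζ : ℂ) {ℓ : ℕ} (v : Fin ℓ → ℂ) (n : ℕ)

noncomputable instance : Ring (CyclotomicHecke ζ v n) :=
  inferInstanceAs (Ring (RingQuot (CyclotomicRel ζ v n)))

noncomputable instance : Algebra ℂ (CyclotomicHecke ζ v n) :=
  inferInstanceAs (Algebra ℂ (RingQuot (CyclotomicRel ζ v n)))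

/-- The quotient map from the affine Hecke algebra. -/
noncomputable def mk : AffineHecke ζ n →ₐ[ℂ] CyclotomicHecke ζ v n :=
  RingQuot.mkAlgHom ℂ (CyclotomicRel ζ v n)

/-- The element `X_i`, `1 ≤ i ≤ n` (and `0` for other `i`). -/
noncomputable def X (i : ℕ) : CyclotomicHecke ζ v n :=
  if hi : 1 ≤ i ∧ i ≤ n then mk ζ v n (AffineHecke.mk ζ n (AffineHeckeGen.x i hi)) else 0

/-- The element `T_i`, `0 ≤ i < n`, where `T_0 = X_1` (and `0` for `i ≥ n`, `i ≠ 0`). -/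
noncomputable def T (i : ℕ) : CyclotomicHecke ζ v n :=
  if i = 0 then X ζ v n 1
  else if hi : 1 ≤ i ∧ i < n then mk ζ v n (AffineHecke.mk ζ n (AffineHeckeGen.t i hi)) else 0

/-- The parabolic subalgebra `H(Γ_I)` generated by the `T_i`, `i ∈ I`, for
`I ⊆ {0, 1, …, n-1}`. -/
noncomputable def parabolic (I : Set ℕ) : Subalgebra ℂ (CyclotomicHecke ζ v n) :=
  Algebra.adjoin ℂ (T ζ v n '' I)

/-- `H(Γ_k)` inside `H(Γ_n)`, `k ≤ n`. -/
noncomputable def subGamma (k : ℕ) : Subalgebra ℂ (CyclotomicHecke ζ v n) :=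
  parabolic ζ v n (Set.Iio k)

/-- `H(Γ_{a,b})` inside `H(Γ_n)`, `a + b ≤ n`, where `Γ_{a,b} = Γ_a × 𝔖_b`. -/
noncomputable def subGammaSym (a b : ℕ) : Subalgebra ℂ (CyclotomicHecke ζ v n) :=
  parabolic ζ v n (Set.Iio (a + b) \ {a})

variable {n}

theorem T_mem {I : Set ℕ} {i : ℕ} (hi : i ∈ I) : T ζ v n i ∈ parabolic ζ v n I :=
  Algebra.subset_adjoin ⟨i, hi, rfl⟩

theorem parabolic_mono {I J : Set ℕ} (h : I ⊆ J) : parabolic ζ v n I ≤ parabolic ζ v n J :=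
  Algebra.adjoin_mono (Set.image_mono h)

theorem T_mul_X_mul_T {i : ℕ} (hi : 1 ≤ i ∧ i < n) :
    T ζ v n i * X ζ v n i * T ζ v n i = ζ • X ζ v n (i + 1) := by
  have h : i ≠ 0 := by omega
  have h1 : 1 ≤ i ∧ i ≤ n := ⟨hi.1, hi.2.le⟩
  have h2 : 1 ≤ i + 1 ∧ i + 1 ≤ n := ⟨by omega, hi.2⟩
  simp only [T, X, if_neg h, dif_pos hi, dif_pos h1, dif_pos h2, ← map_mul, ← map_smul]
  congr 1
  exact RingQuot.mkAlgHom_rel ℂ (AffineHeckeRel.t_x_t i hi)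

theorem X_mem (hζ : ζ ≠ 0) {I : Set ℕ} {i : ℕ} (hi : 1 ≤ i ∧ i ≤ n) (hI : Set.Iio i ⊆ I) :
    X ζ v n i ∈ parabolic ζ v n I := by
  obtain ⟨h1, h2⟩ := hi
  induction i, h1 using Nat.le_induction with
  | base =>
    have := T_mem ζ v (n := n) (hI (show 0 < 1 by omega))
    simpa [T] using this
  | succ i hi ih =>
    have hX : X ζ v n (i + 1) = ζ⁻¹ • (T ζ v n i * X ζ v n i * T ζ v n i) := by
      rw [T_mul_X_mul_T ζ v ⟨hi, h2⟩, smul_smul, inv_mul_cancel₀ hζ, one_smul]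
    have hT := T_mem ζ v (n := n) (hI (show i < i + 1 by omega))
    rw [hX]
    exact Subalgebra.smul_mem _ (mul_mem (mul_mem hT
      (ih (fun k hk => hI (show k < i + 1 from Nat.lt_succ_of_lt hk)) (by omega))) hT) _

theorem subGammaSym_le_subGamma {a b k : ℕ} (h : a + b ≤ k) :
    subGammaSym ζ v n a b ≤ subGamma ζ v n k :=
  parabolic_mono ζ v fun _ hi => lt_of_lt_of_le hi.1 h

theorem subGammaSym_le_subGammaSym {a b c : ℕ} (h : b ≤ c) :
    subGammaSym ζ v n a b ≤ subGammaSym ζ v n a c :=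
  parabolic_mono ζ v fun _ hi => ⟨lt_of_lt_of_le hi.1 (Nat.add_le_add_left h a), hi.2⟩

end CyclotomicHecke

/-! ### Reduced expressions and the elements `T_{i,j}` -/

namespace CyclotomicHecke

/-- The product `s_{i_1} s_{i_2} ⋯ s_{i_k}` of simple transpositions `s_i = (i, i+1)`. -/
def wordPerm (l : List ℕ) : Equiv.Perm ℕ := (l.map fun i => Equiv.swap i (i + 1)).prod

/-- `l` is a reduced expression of `w`. -/
def IsReducedExpr (w : Equiv.Perm ℕ) (l : List ℕ) : Prop :=
  wordPerm l = w ∧ ∀ l' : List ℕ, wordPerm l' = w → l.length ≤ l'.length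

/-- The word `i, i+1, …, j-2, j-1, j-2, …, i+1, i`; it is empty if `i = j`. -/
def transpositionWord (i j : ℕ) : List ℕ :=
  List.range' i (j - i) ++ (List.range' i (j - 1 - i)).reverse

theorem wordPerm_transpositionWord {i j : ℕ} (h : i ≤ j) :
    wordPerm (transpositionWord i j) = Equiv.swap i j := by
  obtain ⟨d, rfl⟩ := Nat.exists_eq_add_of_le h
  clear h
  induction d generalizing i with
  | zero =>
    simp [wordPerm, transpositionWord]
    rfl
  | succ d ih =>
    rcases Nat.eq_zero_or_pos d with rfl | hd
    · simp [wordPerm, transpositionWord]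
    have hw : transpositionWord i (i + (d + 1)) =
        i :: (transpositionWord (i + 1) (i + 1 + d) ++ [i]) := by
      obtain ⟨e, rfl⟩ : ∃ e, d = e + 1 := ⟨d - 1, by omega⟩
      have e1 : i + (e + 1 + 1) - i = (e + 1) + 1 := by omega
      have e2 : i + (e + 1 + 1) - 1 - i = e + 1 := by omega
      have e3 : i + 1 + (e + 1) - (i + 1) = e + 1 := by omega
      have e4 : i + 1 + (e + 1) - 1 - (i + 1) = e := by omega
      simp only [transpositionWord, e1, e2, e3, e4]
      rw [List.range'_succ (n := e + 1), List.range'_succ (s := i) (n := e), List.reverse_cons]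
      simp
    have ih' := ih (i := i + 1)
    simp only [wordPerm] at ih' ⊢
    rw [hw]
    simp only [List.map_cons, List.map_append, List.prod_cons, List.prod_append, ih',
      List.map_nil, List.prod_nil, mul_one]
    have hsw := Equiv.swap_mul_swap_mul_swap (x := i + 1 + d) (y := i + 1) (z := i)
      (by omega) (by omega)
    rw [← mul_assoc, Equiv.swap_comm i (i + 1), show i + (d + 1) = i + 1 + d by omega,
      Equiv.swap_comm (i + 1) (i + 1 + d)]
    exact hsw

/-- The inversions of a permutation. -/
def inversions (w : Equiv.Perm ℕ) : Set (ℕ × ℕ) := {q | q.1 < q.2 ∧ w q.2 < w q.1}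

theorem inversions_wordPerm (l : List ℕ) :
    (inversions (wordPerm l)).Finite ∧ (inversions (wordPerm l)).ncard ≤ l.length := by
  induction l with
  | nil =>
    have : inversions (wordPerm []) = ∅ := by
      ext ⟨a, b⟩
      simp [inversions, wordPerm]
      omega
    simp [this]
  | cons i l ih =>
    set w := wordPerm l with hw
    have hsub : inversions (wordPerm (i :: l)) ⊆
        insert (w.symm i, w.symm (i + 1)) (inversions w) := by
      rintro ⟨a, b⟩ ⟨hab, hlt⟩
      have hlt' : Equiv.swap i (i + 1) (w b) < Equiv.swap i (i + 1) (w a) := by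
        simpa [wordPerm, hw] using hlt
      by_cases hc : w b < w a
      · exact Or.inr ⟨hab, hc⟩
      · left
        have hne : w a ≠ w b := fun h => by
          have := w.injective h
          simp only at hab
          omega
        have h2 : w a = i ∧ w b = i + 1 := by
          simp only [Equiv.swap_apply_def] at hlt'
          split_ifs at hlt' <;> omega
        rw [← h2.2, ← h2.1]
        simp
    refine ⟨(ih.1.insert _).subset hsub, ?_⟩
    calc _ ≤ (insert (w.symm i, w.symm (i + 1)) (inversions w)).ncard :=
          Set.ncard_le_ncard hsub (ih.1.insert _)
      _ ≤ (inversions w).ncard + 1 := Set.ncard_insert_le _ _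
      _ ≤ _ := by simpa using ih.2

/-- The word `transpositionWord i j` is a reduced expression of the transposition `(i, j)`. -/
theorem isReducedExpr_transpositionWord {i j : ℕ} (h : i ≤ j) :
    IsReducedExpr (Equiv.swap i j) (transpositionWord i j) := by
  refine ⟨wordPerm_transpositionWord h, fun l' hl' => ?_⟩
  rcases h.eq_or_lt with rfl | h
  · simp [transpositionWord]
  obtain ⟨hfin, hcard⟩ := inversions_wordPerm l'
  rw [hl'] at hfin hcard
  refine le_trans ?_ hcard
  let s : Finset (ℕ × ℕ) := (Finset.Ioc i j).image (fun k => (i, k)) ∪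
    (Finset.Ioo i j).image (fun k => (k, j))
  have hs : (s : Set (ℕ × ℕ)) ⊆ inversions (Equiv.swap i j) := by
    rintro ⟨a, b⟩ hab
    simp only [s, Finset.coe_union, Finset.coe_image, Set.mem_union, Set.mem_image,
      Finset.coe_Ioc, Finset.coe_Ioo, Set.mem_Ioc, Set.mem_Ioo, Prod.mk.injEq] at hab
    simp only [inversions, Set.mem_ofPred_eq, Equiv.swap_apply_def]
    rcases hab with ⟨k, hk, rfl, rfl⟩ | ⟨k, hk, rfl, rfl⟩ <;> split_ifs <;> omega
  have hsc : s.card = (transpositionWord i j).length := by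
    rw [Finset.card_union_of_disjoint, Finset.card_image_of_injective,
      Finset.card_image_of_injective]
    · simp [transpositionWord]
      omega
    · intro a b hab
      simpa using hab
    · intro a b hab
      simpa using hab
    · rw [Finset.disjoint_left]
      rintro ⟨a, b⟩ h1 h2
      simp only [Finset.mem_image, Finset.mem_Ioc, Finset.mem_Ioo, Prod.mk.injEq] at h1 h2
      obtain ⟨k, hk, rfl, rfl⟩ := h1
      obtain ⟨k', hk', rfl, rfl⟩ := h2
      omega
  rw [← hsc, ← Set.ncard_coe_finset]
  exact Set.ncard_le_ncard hs hfin

/-- `T_{i,j} = T_w` for `w` the transposition `(i, j)`, `1 ≤ i ≤ j ≤ n`: the product of the `T`'s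
along a reduced expression of `(i, j)`. In particular `T_{j,j} = 1`. -/
noncomputable def Ttr (ζ : ℂ) {ℓ : ℕ} (v : Fin ℓ → ℂ) (n : ℕ) (i j : ℕ) : CyclotomicHecke ζ v n :=
  ((transpositionWord i j).map (T ζ v n)).prod

end CyclotomicHecke

/-! ### Tensor products over a noncommutative algebra -/

section BalancedTensor

variable {A R S : Type*} [Ring A] [Ring R] [Ring S] [Algebra ℂ A] [Algebra ℂ R] [Algebra ℂ S]

/-- The subspace of `R ⊗_ℂ S` spanned by the `r f(a) ⊗ s - r ⊗ g(a) s`. -/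
def balancedSubmodule (f : A →ₐ[ℂ] R) (g : A →ₐ[ℂ] S) : Submodule ℂ (R ⊗[ℂ] S) :=
  Submodule.span ℂ {z | ∃ (r : R) (a : A) (s : S), z = (r * f a) ⊗ₜ[ℂ] s - r ⊗ₜ[ℂ] (g a * s)}

/-- The tensor product `R ⊗_A S`, where `R` is a right `A`-module through `f` and `S` is a left
`A`-module through `g`. -/
abbrev BalancedTensor (f : A →ₐ[ℂ] R) (g : A →ₐ[ℂ] S) : Type _ :=
  (R ⊗[ℂ] S) ⧸ balancedSubmodule f g

namespace BalancedTensor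

/-- The pure tensor `r ⊗ s`. -/
def tmul (f : A →ₐ[ℂ] R) (g : A →ₐ[ℂ] S) (r : R) (s : S) : BalancedTensor f g :=
  (balancedSubmodule f g).mkQ (r ⊗ₜ[ℂ] s)

theorem tmul_balanced (f : A →ₐ[ℂ] R) (g : A →ₐ[ℂ] S) (r : R) (a : A) (s : S) :
    tmul f g (r * f a) s = tmul f g r (g a * s) :=
  (Submodule.Quotient.eq _).2 (Submodule.subset_span ⟨r, a, s, rfl⟩)

/-- The left action of `u ∈ R` on `R ⊗_A S`. -/
def leftMul (f : A →ₐ[ℂ] R) (g : A →ₐ[ℂ] S) (u : R) :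
    BalancedTensor f g →ₗ[ℂ] BalancedTensor f g :=
  (balancedSubmodule f g).mapQ _ (LinearMap.rTensor S (LinearMap.mulLeft ℂ u)) (by
    rw [balancedSubmodule, Submodule.span_le]
    rintro _ ⟨r, a, s, rfl⟩
    exact Submodule.subset_span ⟨u * r, a, s, by simp [mul_assoc]⟩)

/-- The right action of `w ∈ S` on `R ⊗_A S`. -/
def rightMul (f : A →ₐ[ℂ] R) (g : A →ₐ[ℂ] S) (w : S) :
    BalancedTensor f g →ₗ[ℂ] BalancedTensor f g :=
  (balancedSubmodule f g).mapQ _ (LinearMap.lTensor R (LinearMap.mulRight ℂ w)) (by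
    rw [balancedSubmodule, Submodule.span_le]
    rintro _ ⟨r, a, s, rfl⟩
    exact Submodule.subset_span ⟨r, a, s * w, by simp [mul_assoc]⟩)

theorem leftMul_tmul (f : A →ₐ[ℂ] R) (g : A →ₐ[ℂ] S) (u r : R) (s : S) :
    leftMul f g u (tmul f g r s) = tmul f g (u * r) s := rfl

theorem rightMul_tmul (f : A →ₐ[ℂ] R) (g : A →ₐ[ℂ] S) (w : S) (r : R) (s : S) :
    rightMul f g w (tmul f g r s) = tmul f g r (s * w) := rfl

end BalancedTensor

/-- For subalgebras `P`, `Q` of `H` and an element `h`: the `(P, Q)`-subbimodule `P h Q` of `H`,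
that is, the span of all `x * h * y` with `x ∈ P`, `y ∈ Q`. -/
def bimoduleSpan {H : Type*} [Ring H] [Algebra ℂ H] (P : Subalgebra ℂ H) (h : H)
    (Q : Subalgebra ℂ H) : Submodule ℂ H :=
  Submodule.span ℂ {z | ∃ x ∈ P, ∃ y ∈ Q, z = x * h * y}

/-- `P ⊗_A Q` and the subspace `M` of `H` are isomorphic as `(P, Q)`-bimodules, the actions on `M`
being the multiplications of `H`. -/
def IsBimoduleIsoTensor {H : Type*} [Ring H] [Algebra ℂ H] {P Q : Subalgebra ℂ H}
    (f : A →ₐ[ℂ] P) (g : A →ₐ[ℂ] Q) (M : Submodule ℂ H) : Prop :=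
  ∃ e : BalancedTensor f g ≃ₗ[ℂ] M,
    (∀ (u : P) (z : BalancedTensor f g),
      (e (BalancedTensor.leftMul f g u z) : H) = (u : H) * (e z : H)) ∧
    (∀ (w : Q) (z : BalancedTensor f g),
      (e (BalancedTensor.rightMul f g w z) : H) = (e z : H) * (w : H))

end BalancedTensor

/-!
The substance of the theorem is that `H(Γ_N)`, `N ≥ 2`, has dimension at least `ℓ N` times that of
`H(Γ_{N-1})`; everything else is a matter of spanning sets.

For the lower bound a right `H(Γ_N)`-module is constructed directly over `A = H(Γ_{N-1})`, of which
only the presentation is used. With `B = ℂ[τ]/((τ - v_1) ⋯ (τ - v_ℓ))`, the module is the sum of `N`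
copies of `A ⊗ B`, with entries `F_j(a ⊗ q)`, `1 ≤ j ≤ N`, which behave like the products
`a T_{N-1} ⋯ T_1 q(X_1) T_1⁻¹ ⋯ T_{j-1}⁻¹`. The action of the `T_i` with `i ≥ 1` is forced by the
braid relations, and that of `T_0 = X_1` by the exchange rule `exchange_of_aeval`, which involves the
map `μ : a ⊗ q ↦ a q(X_1)`. The relations of type `B` are verified in `isTypeBHecke_act`, the
polynomial relation in `aeval_act_zero`; by `exists_lift` these relations present `H(Γ_N)`. The vector
`F_N(1)` generates the module, so its dimension `ℓ N dim A` is a lower bound for `dim H(Γ_N)`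
(`le_finrank`).

In the other direction, the products `T_{k-1} ⋯ T_j X_j^p` span a subspace stable under
multiplication by `T_i`, `i < k`, from the right (`desc_mul_T`). In particular all algebras are
finite-dimensional. Hence every family of `ℓ N` elements which spans `H(Γ_N)` over the image of
`H(Γ_{N-1})` is a basis, and `H(Γ_{N-1})` embeds (`finrank_subGamma_and_linearIndependent`). This is
applied to the family in (a), and to the family of the `T_{N-1} ⋯ T_j X_j^p` with `j ≤ n` and the
`X_N^p T_{N-1} ⋯ T_j` with `j > n` (`mixedFamily`), which is adapted to the bimodules in (b).

Put `u = T_{N-1} ⋯ T_n`. It differs from `T_{n,N}` by a unit of `H(Γ_{N-1})`, and `φ` is conjugation by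
`u` (`exists_shift`). The isomorphisms in (c) are `r ⊗ s ↦ r u s` and `r ⊗ s ↦ r X_N^p s`. They are
injective because generators `q_i` of `H(Γ_{n,m})` over the smaller algebra yield elements `u q_i`,
respectively `X_N^p q_i`, of the mixed basis (`isBimoduleIsoTensor_of_linearIndependent`); no
freeness of `H(Γ_{n,m})` is needed for this.
-/

/-! ### The presentation of type `B` -/

/-- A subspace stable under right multiplication by generators is stable under right multiplication
by the subalgebra which they generate. -/
theorem Submodule.mul_mem_of_mem_adjoin {R : Type*} [Ring R] [Algebra ℂ R] {p : Submodule ℂ R}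
    {S : Set R} (h : ∀ z ∈ p, ∀ g ∈ S, z * g ∈ p) {z y : R} (hz : z ∈ p)
    (hy : y ∈ Algebra.adjoin ℂ S) : z * y ∈ p := by
  induction hy using Algebra.adjoin_induction generalizing z with
  | mem x hx => exact h z hz x hx
  | algebraMap r =>
    rw [Algebra.algebraMap_eq_smul_one, mul_smul_comm, mul_one]
    exact p.smul_mem r hz
  | add x y _ _ hx hy => rw [mul_add]; exact add_mem (hx hz) (hy hz)
  | mul x y _ _ hx hy => rw [← mul_assoc]; exact hy (hx hz)

/-- A family `t_0, t_1, …` whose members with index `< N` satisfy the defining relations of the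
Hecke algebra of type `B_N`, except for the polynomial relation on `t_0`. -/
structure IsTypeBHecke (ζ : ℂ) (N : ℕ) {R : Type*} [Ring R] [Algebra ℂ R] (t : ℕ → R) : Prop where
  quad : ∀ i, 1 ≤ i → i < N → t i * t i = (ζ - 1) • t i + ζ • (1 : R)
  comm : ∀ i j, i + 1 < j → j < N → t i * t j = t j * t i
  braid : ∀ i, 1 ≤ i → i + 1 < N → t i * t (i + 1) * t i = t (i + 1) * t i * t (i + 1)
  braidB : 1 < N → t 0 * t 1 * t 0 * t 1 = t 1 * t 0 * t 1 * t 0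

/-- The elements `x_1 = t_0`, `x_{i+1} = ζ⁻¹ t_i x_i t_i` (and the junk value `x_0 = 0`). -/
noncomputable def jucysMurphy (ζ : ℂ) {R : Type*} [Ring R] [Algebra ℂ R] (t : ℕ → R) : ℕ → R
  | 0 => 0
  | 1 => t 0
  | (i + 2) => ζ⁻¹ • (t (i + 1) * jucysMurphy ζ t (i + 1) * t (i + 1))

/-- The inverse of `t_i` provided by the quadratic relation. -/
noncomputable def heckeInv (ζ : ℂ) {R : Type*} [Ring R] [Algebra ℂ R] (t : ℕ → R) (i : ℕ) : R :=
  ζ⁻¹ • t i - (1 - ζ⁻¹) • (1 : R)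

section TypeB

variable {ζ : ℂ} {N : ℕ} {R : Type*} [Ring R] [Algebra ℂ R] {t : ℕ → R}

theorem jucysMurphy_succ {i : ℕ} (hi : 1 ≤ i) :
    jucysMurphy ζ t (i + 1) = ζ⁻¹ • (t i * jucysMurphy ζ t i * t i) := by
  obtain ⟨i, rfl⟩ : ∃ k, i = k + 1 := ⟨i - 1, by omega⟩
  rfl

namespace IsTypeBHecke

variable (h : IsTypeBHecke ζ N t)
include h

theorem mono {k : ℕ} (hk : k ≤ N) : IsTypeBHecke ζ k t :=
  ⟨fun i h1 h2 => h.quad i h1 (by omega), fun i j h1 h2 => h.comm i j h1 (by omega),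
    fun i h1 h2 => h.braid i h1 (by omega), fun h1 => h.braidB (by omega)⟩

theorem map {S : Type*} [Ring S] [Algebra ℂ S] (f : R →ₐ[ℂ] S) :
    IsTypeBHecke ζ N fun i => f (t i) where
  quad i h1 h2 := by
    simpa only [map_mul, map_add, map_smul, map_one] using congrArg f (h.quad i h1 h2)
  comm i j hij hj := by simpa only [map_mul] using congrArg f (h.comm i j hij hj)
  braid i h1 h2 := by simpa only [map_mul] using congrArg f (h.braid i h1 h2)
  braidB hN := by simpa only [map_mul] using congrArg f (h.braidB hN)

theorem commute {i j : ℕ} (hij : i + 1 < j ∨ j + 1 < i) (hi : i < N) (hj : j < N) :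
    Commute (t i) (t j) := by
  rcases hij with hij | hij
  · exact h.comm i j hij hj
  · exact (h.comm j i hij hi).symm

theorem mul_heckeInv (hζ : ζ ≠ 0) {i : ℕ} (h1 : 1 ≤ i) (h2 : i < N) :
    t i * heckeInv ζ t i = 1 := by
  simp only [heckeInv, mul_sub, mul_smul_comm, h.quad i h1 h2, mul_one]
  match_scalars <;> field_simp; ring

theorem heckeInv_mul (hζ : ζ ≠ 0) {i : ℕ} (h1 : 1 ≤ i) (h2 : i < N) :
    heckeInv ζ t i * t i = 1 := by
  simp only [heckeInv, sub_mul, smul_mul_assoc, h.quad i h1 h2, one_mul]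
  match_scalars <;> field_simp; ring

theorem commute_jucysMurphy_of_lt {i j : ℕ} (h1 : 1 ≤ i) (hij : i < j) (hj : j < N) :
    Commute (t j) (jucysMurphy ζ t i) := by
  induction i, h1 using Nat.le_induction with
  | base => exact h.commute (Or.inr hij) hj (by omega)
  | succ i hi ih =>
    rw [jucysMurphy_succ hi]
    have hc : Commute (t j) (t i) := h.commute (Or.inr hij) hj (by omega)
    exact ((hc.mul_right (ih (by omega))).mul_right hc).smul_right _

/-- The case `i = j + 2` is the braid relation; the others follow from the recursion. -/
theorem commute_jucysMurphy_of_gt {i j : ℕ} (h1 : 1 ≤ j) (hij : j + 1 < i) (hi : i ≤ N) :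
    Commute (t j) (jucysMurphy ζ t i) := by
  induction i, hij using Nat.le_induction with
  | base =>
    rw [Nat.succ_eq_add_one, jucysMurphy_succ (by omega), jucysMurphy_succ h1]
    have hb := h.braid j h1 (by omega)
    have hc : t (j + 1) * jucysMurphy ζ t j = jucysMurphy ζ t j * t (j + 1) :=
      h.commute_jucysMurphy_of_lt h1 (by omega) (by omega)
    simp only [mul_smul_comm, smul_mul_assoc]
    refine Commute.smul_right (Commute.smul_right ?_ _) _
    rw [commute_iff_eq]
    -- the braid relation is applied on the left, and again, after `t_{j+1}` has crossed `x_j`,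
    -- on the right
    calc t j * (t (j + 1) * (t j * jucysMurphy ζ t j * t j) * t (j + 1))
        = (t j * t (j + 1) * t j) * jucysMurphy ζ t j * (t j * t (j + 1)) := by noncomm_ring
      _ = t (j + 1) * t j * (t (j + 1) * jucysMurphy ζ t j) * (t j * t (j + 1)) := by
        rw [hb]; noncomm_ring
      _ = t (j + 1) * t j * jucysMurphy ζ t j * (t (j + 1) * t j * t (j + 1)) := by
        rw [hc]; noncomm_ring
      _ = _ := by rw [← hb]; noncomm_ring
  | succ i hij ih =>
    rw [jucysMurphy_succ (by omega)]
    have hc : Commute (t j) (t i) := h.commute (Or.inl (by omega)) (by omega) (by omega)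
    exact ((hc.mul_right (ih (by omega))).mul_right hc).smul_right _

theorem commute_jucysMurphy_of_ne {i j : ℕ} (hj : 1 ≤ j ∧ j < N) (hi : 1 ≤ i ∧ i ≤ N)
    (h1 : i ≠ j) (h2 : i ≠ j + 1) : Commute (t j) (jucysMurphy ζ t i) := by
  rcases lt_or_gt_of_ne h1 with h3 | h3
  · exact h.commute_jucysMurphy_of_lt hi.1 h3 hj.2
  · exact h.commute_jucysMurphy_of_gt hj.1 (by omega) hi.2

theorem commute_zero_jucysMurphy {i : ℕ} (h1 : 1 ≤ i) (hi : i ≤ N) :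
    Commute (t 0) (jucysMurphy ζ t i) := by
  induction i, h1 using Nat.le_induction with
  | base => exact Commute.refl _
  | succ i hi' ih =>
    rw [jucysMurphy_succ hi']
    rcases hi'.eq_or_lt with rfl | hlt
    · refine Commute.smul_right ?_ _
      have := h.braidB (by omega)
      rw [commute_iff_eq]
      simpa [jucysMurphy, mul_assoc] using this
    · have hc : Commute (t 0) (t i) := h.commute (Or.inl (by omega)) (by omega) (by omega)
      exact ((hc.mul_right (ih (by omega))).mul_right hc).smul_right _

theorem commute_jucysMurphy {i j : ℕ} (hi : 1 ≤ i ∧ i ≤ N) (hj : 1 ≤ j ∧ j ≤ N) :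
    Commute (jucysMurphy ζ t i) (jucysMurphy ζ t j) := by
  have key : ∀ i, 1 ≤ i → ∀ j, i < j → j ≤ N →
      Commute (jucysMurphy ζ t i) (jucysMurphy ζ t j) := by
    intro i h1
    induction i, h1 using Nat.le_induction with
    | base => exact fun j h1 h2 => h.commute_zero_jucysMurphy (by omega) h2
    | succ i hi ih =>
      intro j h1 h2
      rw [jucysMurphy_succ hi]
      have hc : Commute (t i) (jucysMurphy ζ t j) :=
        h.commute_jucysMurphy_of_gt hi (by omega) h2
      exact ((hc.mul_left (ih j (by omega) h2)).mul_left hc).smul_left _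
  rcases lt_trichotomy i j with hij | rfl | hij
  · exact key i hi.1 j hij hj.2
  · exact Commute.refl _
  · exact (key j hj.1 i hij hi.2).symm

end IsTypeBHecke

end TypeB

namespace CyclotomicHecke

/-- The images of the generators `X_i` and `T_i` under the homomorphism defined by a family `t`. -/
noncomputable def genImage (ζ : ℂ) {N : ℕ} {R : Type*} [Ring R] [Algebra ℂ R] (t : ℕ → R) :
    AffineHeckeGen N → R
  | .X i _ => jucysMurphy ζ t i
  | .T i _ => t i

/-- A presentation of the cyclotomic Hecke algebra by the `T_i` alone: the relations of type `B`
together with `∏ (T_0 - v_p) = 0` suffice. -/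
theorem exists_lift {ζ : ℂ} (hζ : ζ ≠ 0) {ℓ : ℕ} (v : Fin ℓ → ℂ) {N : ℕ} {R : Type*} [Ring R]
    [Algebra ℂ R] {t : ℕ → R} (h : IsTypeBHecke ζ N t)
    (hP : 1 ≤ N → (List.ofFn fun p : Fin ℓ => t 0 - algebraMap ℂ R (v p)).prod = 0) :
    ∃ f : CyclotomicHecke ζ v N →ₐ[ℂ] R, (1 ≤ N → f (T ζ v N 0) = t 0) ∧
      ∀ i, 1 ≤ i → i < N → f (T ζ v N i) = t i := by
  let f₀ : FreeAlgebra ℂ (AffineHeckeGen N) →ₐ[ℂ] R := FreeAlgebra.lift ℂ (genImage ζ t)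
  have hx : ∀ i hi, f₀ (AffineHeckeGen.x i hi) = jucysMurphy ζ t i := fun i hi => by
    simp [f₀, AffineHeckeGen.x, genImage]
  have ht : ∀ i hi, f₀ (AffineHeckeGen.t i hi) = t i := fun i hi => by
    simp [f₀, AffineHeckeGen.t, genImage]
  have h₁ : ∀ ⦃a b⦄, AffineHeckeRel ζ N a b → f₀ a = f₀ b := by
    intro a b hab
    cases hab with
    | x_comm i j hi hj =>
      simp only [map_mul, hx]
      exact h.commute_jucysMurphy hi hj
    | t_x_comm i j hi hj h1 h2 =>
      simp only [map_mul, hx, ht]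
      exact h.commute_jucysMurphy_of_ne hi hj h1 h2
    | t_x_t i hi =>
      simp only [map_mul, map_smul, hx, ht]
      rw [jucysMurphy_succ hi.1, smul_smul, mul_inv_cancel₀ hζ, one_smul]
    | quadratic i hi =>
      simp only [map_mul, map_add, map_sub, map_one, map_zero, ht, map_smul,
        Algebra.algebraMap_eq_smul_one]
      simp only [add_mul, mul_sub, h.quad i hi.1 hi.2, mul_smul_comm, mul_one, one_mul]
      module
    | t_comm i j hi hj hij =>
      simp only [map_mul, ht]
      exact h.commute hij hi.2 hj.2
    | braid i hi hi' =>
      simp only [map_mul, ht]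
      exact h.braid i hi.1 hi'.2
  let f₁ : AffineHecke ζ N →ₐ[ℂ] R := RingQuot.liftAlgHom ℂ ⟨f₀, h₁⟩
  have hf₁ : ∀ a, f₁ (AffineHecke.mk ζ N a) = f₀ a := fun a =>
    RingQuot.liftAlgHom_mkAlgHom_apply ℂ f₀ h₁ a
  have h₂ : ∀ ⦃a b⦄, CyclotomicRel ζ v N a b → f₁ a = f₁ b := by
    intro a b hab
    cases hab with
    | mk hN =>
      rw [map_zero, map_list_prod, List.map_ofFn, ← hP hN.2]
      congr 2
      funext p
      simp [hf₁, hx, jucysMurphy]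
  let f₂ : CyclotomicHecke ζ v N →ₐ[ℂ] R := RingQuot.liftAlgHom ℂ ⟨f₁, h₂⟩
  have hf₂ : ∀ a, f₂ (mk ζ v N a) = f₁ a := fun a =>
    RingQuot.liftAlgHom_mkAlgHom_apply ℂ f₁ h₂ a
  refine ⟨f₂, fun hN => ?_, fun i h1 h2 => ?_⟩
  · rw [T, if_pos rfl, X, dif_pos ⟨le_rfl, hN⟩, hf₂, hf₁, hx, jucysMurphy]
  · rw [T, if_neg (by omega), dif_pos ⟨h1, h2⟩, hf₂, hf₁, ht]

section Relations

variable (ζ : ℂ) {ℓ : ℕ} (v : Fin ℓ → ℂ) {N : ℕ}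

theorem X_of_le {i : ℕ} (hi : 1 ≤ i ∧ i ≤ N) :
    X ζ v N i = mk ζ v N (AffineHecke.mk ζ N (AffineHeckeGen.x i hi)) := dif_pos hi

theorem T_of_lt {i : ℕ} (hi : 1 ≤ i ∧ i < N) :
    T ζ v N i = mk ζ v N (AffineHecke.mk ζ N (AffineHeckeGen.t i hi)) := by
  rw [T, if_neg (by omega), dif_pos hi]

theorem T_zero : T ζ v N 0 = X ζ v N 1 := if_pos rfl

theorem mk_rel {a b : FreeAlgebra ℂ (AffineHeckeGen N)} (h : AffineHeckeRel ζ N a b) :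
    mk ζ v N (AffineHecke.mk ζ N a) = mk ζ v N (AffineHecke.mk ζ N b) :=
  congrArg _ (RingQuot.mkAlgHom_rel ℂ h)

theorem X_comm {i j : ℕ} (hi : 1 ≤ i ∧ i ≤ N) (hj : 1 ≤ j ∧ j ≤ N) :
    Commute (X ζ v N i) (X ζ v N j) := by
  rw [X_of_le ζ v hi, X_of_le ζ v hj, commute_iff_eq]
  simpa only [map_mul] using mk_rel ζ v (AffineHeckeRel.x_comm i j hi hj)

theorem T_X_comm {i j : ℕ} (hi : 1 ≤ i ∧ i < N) (hj : 1 ≤ j ∧ j ≤ N) (h1 : j ≠ i)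
    (h2 : j ≠ i + 1) : Commute (T ζ v N i) (X ζ v N j) := by
  rw [X_of_le ζ v hj, T_of_lt ζ v hi, commute_iff_eq]
  simpa only [map_mul] using mk_rel ζ v (AffineHeckeRel.t_x_comm i j hi hj h1 h2)

theorem T_quad {i : ℕ} (h1 : 1 ≤ i) (h2 : i < N) :
    T ζ v N i * T ζ v N i = (ζ - 1) • T ζ v N i + ζ • (1 : CyclotomicHecke ζ v N) := by
  have := mk_rel ζ v (AffineHeckeRel.quadratic i ⟨h1, h2⟩)
  simp only [map_mul, map_add, map_sub, map_one, map_zero, map_smul,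
    Algebra.algebraMap_eq_smul_one, ← T_of_lt ζ v ⟨h1, h2⟩] at this
  simp only [add_mul, mul_sub, mul_smul_comm, mul_one, one_mul] at this
  rw [← sub_eq_zero, ← this]
  module

theorem isTypeBHecke_T : IsTypeBHecke ζ N (T ζ v N) where
  quad _ h1 h2 := T_quad ζ v h1 h2
  comm i j hij hj := by
    rcases Nat.eq_zero_or_pos i with rfl | hi
    · rw [T_zero]
      exact (T_X_comm ζ v ⟨by omega, hj⟩ ⟨le_rfl, by omega⟩ (by omega) (by omega)).symm
    · rw [T_of_lt ζ v ⟨hi, by omega⟩, T_of_lt ζ v ⟨by omega, hj⟩]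
      simpa only [map_mul] using mk_rel ζ v
        (AffineHeckeRel.t_comm i j ⟨hi, by omega⟩ ⟨by omega, hj⟩ (Or.inl hij))
  braid i h1 h2 := by
    rw [T_of_lt ζ v ⟨h1, by omega⟩, T_of_lt ζ v ⟨by omega, h2⟩]
    simpa only [map_mul] using mk_rel ζ v
      (AffineHeckeRel.braid i ⟨h1, by omega⟩ ⟨by omega, h2⟩)
  braidB hN := by
    have h1 := T_mul_X_mul_T ζ v (n := N) (i := 1) ⟨le_rfl, hN⟩
    have h2 := (X_comm ζ v (N := N) (i := 1) (j := 1 + 1) ⟨le_rfl, hN.le⟩ ⟨by omega, hN⟩).eq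
    rw [T_zero]
    calc _ = X ζ v N 1 * (T ζ v N 1 * X ζ v N 1 * T ζ v N 1) := by noncomm_ring
      _ = _ := by rw [h1, mul_smul_comm, h2, ← smul_mul_assoc, ← h1]

theorem prod_T_zero_sub (hN : 1 ≤ N) :
    (List.ofFn fun p : Fin ℓ => T ζ v N 0 - algebraMap ℂ _ (v p)).prod = 0 := by
  have : mk ζ v N _ = mk ζ v N 0 := RingQuot.mkAlgHom_rel ℂ (CyclotomicRel.mk ⟨le_rfl, hN⟩)
  rw [map_list_prod, List.map_ofFn, map_zero] at this
  rw [← this, T_zero, X_of_le ζ v ⟨le_rfl, hN⟩]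
  congr 2
  funext p
  simp

/-- The generators `X_i` are redundant. -/
theorem parabolic_Iio_self (hζ : ζ ≠ 0) : parabolic ζ v N (Set.Iio N) = ⊤ := by
  rw [eq_top_iff]
  rintro x -
  obtain ⟨y, rfl⟩ := RingQuot.mkAlgHom_surjective ℂ (CyclotomicRel ζ v N) x
  obtain ⟨z, rfl⟩ := RingQuot.mkAlgHom_surjective ℂ (AffineHeckeRel ζ N) y
  let F : FreeAlgebra ℂ (AffineHeckeGen N) →ₐ[ℂ] CyclotomicHecke ζ v N :=
    (mk ζ v N).comp (AffineHecke.mk ζ N)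
  change F z ∈ _
  have hz : z ∈ Algebra.adjoin ℂ (Set.range (FreeAlgebra.ι ℂ (X := AffineHeckeGen N))) := by
    rw [FreeAlgebra.adjoin_range_ι]; trivial
  induction hz using Algebra.adjoin_induction with
  | mem x hx =>
    obtain ⟨g, rfl⟩ := hx
    cases g with
    | X i hi =>
      have := X_mem ζ v hζ (n := N) (I := Set.Iio N) hi fun k (hk : k < i) =>
        show k < N by omega
      rwa [X_of_le ζ v hi] at this
    | T i hi =>
      have := T_mem ζ v (n := N) (I := Set.Iio N) (i := i) hi.2
      rwa [T_of_lt ζ v hi] at this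
  | algebraMap r => rw [AlgHom.commutes]; exact Subalgebra.algebraMap_mem _ r
  | add x y _ _ hx hy => rw [map_add]; exact add_mem hx hy
  | mul x y _ _ hx hy => rw [map_mul]; exact mul_mem hx hy

end Relations

end CyclotomicHecke

/-! ### Products of inverses -/

/-- The product `t_1⁻¹ t_2⁻¹ ⋯ t_k⁻¹`. -/
noncomputable def invProd (ζ : ℂ) {R : Type*} [Ring R] [Algebra ℂ R] (t : ℕ → R) : ℕ → R
  | 0 => 1
  | k + 1 => invProd ζ t k * heckeInv ζ t (k + 1)

section TypeB

variable {ζ : ℂ} {N : ℕ} {R : Type*} [Ring R] [Algebra ℂ R] {t : ℕ → R}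

theorem Commute.heckeInv_right {a : R} {i : ℕ} (h : Commute a (t i)) :
    Commute a (heckeInv ζ t i) :=
  (h.smul_right _).sub_right ((Commute.one_right a).smul_right _)

namespace IsTypeBHecke

variable (h : IsTypeBHecke ζ N t)
include h

theorem mul_heckeInv_mul_heckeInv (hζ : ζ ≠ 0) {i : ℕ} (h1 : 1 ≤ i) (h2 : i + 1 < N) :
    t (i + 1) * heckeInv ζ t i * heckeInv ζ t (i + 1) =
      heckeInv ζ t i * heckeInv ζ t (i + 1) * t i := by
  have a1 := h.mul_heckeInv hζ h1 (by omega)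
  have a2 := h.heckeInv_mul hζ h1 (by omega)
  have b1 := h.mul_heckeInv hζ (i := i + 1) (by omega) h2
  have b2 := h.heckeInv_mul hζ (i := i + 1) (by omega) h2
  have hb := h.braid i h1 h2
  set u := heckeInv ζ t i
  set w := heckeInv ζ t (i + 1)
  calc t (i + 1) * u * w = u * (w * (t (i + 1) * t i * t (i + 1))) * u * w := by
        rw [show u * (w * (t (i + 1) * t i * t (i + 1))) = u * (w * t (i + 1)) * t i * t (i + 1)
          by noncomm_ring, b2, mul_one, a2, one_mul]
    _ = u * w * t i * (t (i + 1) * (t i * u) * w) := by rw [← hb]; noncomm_ring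
    _ = _ := by rw [a1, mul_one, b1, mul_one]

theorem commute_invProd {i k : ℕ} (hik : k + 1 < i) (hi : i < N) :
    Commute (t i) (invProd ζ t k) := by
  induction k with
  | zero => exact Commute.one_right _
  | succ k ih =>
    exact (ih (by omega)).mul_right
      (h.commute (Or.inr (by omega)) hi (by omega)).heckeInv_right

theorem mul_invProd (hζ : ζ ≠ 0) {i k : ℕ} (h2 : 2 ≤ i) (hik : i ≤ k) (hk : k < N) :
    t i * invProd ζ t k = invProd ζ t k * t (i - 1) := by
  induction k, hik using Nat.le_induction with
  | base =>
    obtain ⟨i, rfl⟩ : ∃ m, i = m + 2 := ⟨i - 2, by omega⟩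
    have hc := h.commute_invProd (i := i + 2) (k := i) (by omega) hk
    have hm := h.mul_heckeInv_mul_heckeInv hζ (i := i + 1) (by omega) hk
    simp only [invProd, show i + 2 - 1 = i + 1 by omega]
    rw [← mul_assoc, ← mul_assoc, hc.eq, mul_assoc, mul_assoc, ← mul_assoc (t (i + 2)), hm]
    simp only [mul_assoc]
  | succ k hik ih =>
    have hc : Commute (t (i - 1)) (heckeInv ζ t (k + 1)) :=
      (h.commute (Or.inl (by omega)) (by omega) hk).heckeInv_right
    rw [invProd, ← mul_assoc, ih (by omega), mul_assoc, hc.eq, mul_assoc]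

theorem invProd_mul_self (hζ : ζ ≠ 0) {k : ℕ} (hk : k + 1 < N) :
    invProd ζ t (k + 1) * t (k + 1) = invProd ζ t k := by
  rw [invProd, mul_assoc, h.heckeInv_mul hζ (by omega) hk, mul_one]

theorem commute_zero_mul_invProd (hζ : ζ ≠ 0) {k : ℕ} (h1 : 1 ≤ k) (hk : k < N) :
    Commute (t 0) (t 1 * invProd ζ t k) := by
  induction k, h1 using Nat.le_induction with
  | base =>
    rw [invProd, invProd, one_mul, h.mul_heckeInv hζ le_rfl hk]
    exact Commute.one_right _
  | succ k h1 ih =>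
    rw [invProd, ← mul_assoc]
    exact (ih (by omega)).mul_right
      (h.commute (Or.inl (by omega)) (by omega) hk).heckeInv_right

end IsTypeBHecke

end TypeB

/-! ### A module over the Hecke algebra, free over the smaller one -/

/-- The linear map `μ` on `E` behaves like the evaluation of polynomials in the central variable
`τ`, with coefficients on the left, at `τ = s_0`. -/
structure IsEvaluation (ζ : ℂ) (n : ℕ) {E : Type*} [Ring E] [Algebra ℂ E] (s : ℕ → E) (τ : E)
    (μ : E →ₗ[ℂ] E) : Prop where
  central : ∀ z, z * τ = τ * z
  mul_var : ∀ z, μ (z * τ) = μ z * s 0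
  mul_of_ne : ∀ z i, i < n → i ≠ 1 → μ (z * s i) = μ z * s i
  mul_conj : ∀ z, 1 < n → μ (z * (s 1 * s 0 * s 1)) = μ z * (s 1 * s 0 * s 1)
  idem : ∀ z, μ (μ z) = μ z
  idem_mul : ∀ z, 1 < n → μ (μ z * s 1) = μ z * s 1
  /-- a consequence of the relation between `s_0` and `s_1`; see `exchange_of_aeval` -/
  exchange : ∀ z, 1 < n → μ (z * s 1) * s 1 * s 0 =
    μ (z * s 0 * s 1) * s 1 + (ζ - 1) • (μ z * s 1 * s 0 - μ (z * s 0 * s 1))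

namespace HeckeModule

variable (N : ℕ) {E : Type*} [Ring E] [Algebra ℂ E]

/-- The vector `F_j(z)`, `1 ≤ j ≤ N`, with the entry `z` in the `j`-th place (and `0` for other
`j`). -/
noncomputable def F (j : ℕ) : E →ₗ[ℂ] (Fin N → E) :=
  if h : 1 ≤ j ∧ j ≤ N then LinearMap.single ℂ (fun _ => E) ⟨j - 1, by omega⟩ else 0

/-- The linear map with prescribed values on the `F_j(z)`. -/
noncomputable def ofValues (c : ℕ → E →ₗ[ℂ] (Fin N → E)) : Module.End ℂ (Fin N → E) :=
  LinearMap.lsum ℂ (fun _ => E) ℂ fun k => c (k + 1)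

variable {N}

theorem ofValues_F (c : ℕ → E →ₗ[ℂ] (Fin N → E)) {j : ℕ} (h1 : 1 ≤ j) (h2 : j ≤ N) (z : E) :
    ofValues N c (F N j z) = c j z := by
  have h : 1 ≤ j ∧ j ≤ N := ⟨h1, h2⟩
  rw [F, dif_pos h, ofValues, LinearMap.coe_single, LinearMap.lsum_piSingle]
  simp [Nat.sub_add_cancel h1]

theorem ext_F {V : Type*} [AddCommGroup V] [Module ℂ V] {f g : (Fin N → E) →ₗ[ℂ] V}
    (h : ∀ j, 1 ≤ j → j ≤ N → ∀ z, f (F N j z) = g (F N j z)) : f = g := by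
  refine LinearMap.pi_ext fun i x => ?_
  have := h (i + 1) (by omega) (by omega) x
  rwa [F, dif_pos ⟨by omega, by omega⟩] at this

variable (N)

/-- The action of `T_i` on the module: the vector `F_j(a q)` behaves like
`a T_{N-1} ⋯ T_1 q(X_1) T_1⁻¹ ⋯ T_{j-1}⁻¹`, multiplied by `T_i` from the right. For `i = 0` and `j ≥ 2`
the term with `μ` arises when `X_1` is moved to the left through `T_1 q(X_1) T_1⁻¹`; what remains of
`T_2⁻¹ ⋯ T_{j-1}⁻¹` then becomes `s_1⁻¹ ⋯ s_{j-2}⁻¹` on the left of `T_{N-1} ⋯ T_1`. -/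
noncomputable def act (ζ : ℂ) (s : ℕ → E) (τ : E) (μ : E →ₗ[ℂ] E) (i : ℕ) :
    Module.End ℂ (Fin N → E) :=
  ofValues N fun j =>
    if i = 0 then
      if j = 1 then F N 1 ∘ₗ LinearMap.mulRight ℂ τ
      else F N j ∘ₗ LinearMap.mulRight ℂ (s 0) +
        (1 - ζ⁻¹) • (F N 1 ∘ₗ LinearMap.mulRight ℂ (invProd ζ s (j - 2) * τ) ∘ₗ (μ - LinearMap.id))
    else if j = i then (ζ - 1) • F N j + ζ • F N (j + 1)
    else if j = i + 1 then F N i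
    else if i + 1 < j then F N j ∘ₗ LinearMap.mulRight ℂ (s i)
    else F N j ∘ₗ LinearMap.mulRight ℂ (s (i - 1))

variable {N} {ζ : ℂ} {s : ℕ → E} {τ : E} {μ : E →ₗ[ℂ] E}

theorem act_zero_one (hN : 1 ≤ N) (z : E) :
    act N ζ s τ μ 0 (F N 1 z) = F N 1 (z * τ) := by
  rw [act, ofValues_F _ le_rfl hN]
  simp

theorem act_zero {j : ℕ} (h1 : 2 ≤ j) (h2 : j ≤ N) (z : E) :
    act N ζ s τ μ 0 (F N j z) = F N j (z * s 0) +
      (1 - ζ⁻¹) • F N 1 ((μ z - z) * invProd ζ s (j - 2) * τ) := by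
  rw [act, ofValues_F _ (by omega) h2, if_pos rfl, if_neg (by omega)]
  simp [mul_assoc]

theorem act_self {i : ℕ} (h1 : 1 ≤ i) (h2 : i ≤ N) (z : E) :
    act N ζ s τ μ i (F N i z) = (ζ - 1) • F N i z + ζ • F N (i + 1) z := by
  rw [act, ofValues_F _ h1 h2, if_neg (by omega), if_pos rfl]
  rfl

theorem act_succ {i : ℕ} (h1 : 1 ≤ i) (h2 : i + 1 ≤ N) (z : E) :
    act N ζ s τ μ i (F N (i + 1) z) = F N i z := by
  rw [act, ofValues_F _ (by omega) h2, if_neg (by omega), if_neg (by omega), if_pos rfl]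

theorem act_of_gt {i j : ℕ} (h1 : 1 ≤ i) (hij : i + 1 < j) (h2 : j ≤ N) (z : E) :
    act N ζ s τ μ i (F N j z) = F N j (z * s i) := by
  rw [act, ofValues_F _ (by omega) h2, if_neg (by omega), if_neg (by omega), if_neg (by omega),
    if_pos hij]
  rfl

theorem act_of_lt {i j : ℕ} (h1 : 1 ≤ j) (hij : j < i) (h2 : j ≤ N) (z : E) :
    act N ζ s τ μ i (F N j z) = F N j (z * s (i - 1)) := by
  rw [act, ofValues_F _ (by omega) h2, if_neg (by omega), if_neg (by omega), if_neg (by omega),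
    if_neg (by omega)]
  rfl

end HeckeModule

/-! ### The relations of type `B` on the module -/

namespace HeckeModule

variable {N : ℕ} {E : Type*} [Ring E] [Algebra ℂ E] {ζ : ℂ} {s : ℕ → E} {τ : E} {μ : E →ₗ[ℂ] E}

theorem act_quad {i : ℕ} (hs : IsTypeBHecke ζ (N - 1) s) (h1 : 1 ≤ i) (h2 : i < N) :
    act N ζ s τ μ i * act N ζ s τ μ i = (ζ - 1) • act N ζ s τ μ i + ζ • 1 := by
  refine ext_F fun j hj hj' z => ?_
  simp only [Module.End.mul_apply, LinearMap.add_apply, LinearMap.smul_apply, Module.End.one_apply]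
  rcases lt_trichotomy j i with h | rfl | h
  · rw [act_of_lt hj h hj', act_of_lt hj h hj', mul_assoc, hs.quad _ (by omega) (by omega),
      mul_add, map_add, mul_smul_comm, mul_smul_comm, map_smul, map_smul, mul_one]
  · rw [act_self h1 h2.le, map_add, map_smul, map_smul, act_self h1 h2.le, act_succ h1 h2]
  · rcases (Nat.succ_le_of_lt h).eq_or_lt with rfl | h
    · rw [Nat.succ_eq_add_one, act_succ h1 h2, act_self h1 h2.le]
    · rw [act_of_gt h1 h hj', act_of_gt h1 h hj', mul_assoc, hs.quad _ (by omega) (by omega),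
        mul_add, map_add, mul_smul_comm, mul_smul_comm, map_smul, map_smul, mul_one]

theorem act_comm_pos {i k : ℕ} (hs : IsTypeBHecke ζ (N - 1) s) (h1 : 1 ≤ i) (hik : i + 1 < k)
    (h2 : k < N) :
    act N ζ s τ μ i * act N ζ s τ μ k = act N ζ s τ μ k * act N ζ s τ μ i := by
  refine ext_F fun j hj hj' z => ?_
  simp only [Module.End.mul_apply]
  have hk1 : 1 ≤ k := by omega
  rcases lt_trichotomy j i with h | rfl | h
  · rw [act_of_lt hj (h.trans (by omega)) hj', act_of_lt hj h hj', act_of_lt hj h hj',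
      act_of_lt hj (h.trans (by omega)) hj', mul_assoc, mul_assoc,
      hs.comm (i - 1) (k - 1) (by omega) (by omega)]
  · rw [act_of_lt hj (by omega) hj', act_self h1 hj', act_self h1 hj', map_add, map_smul,
      map_smul, act_of_lt hj (by omega) hj', act_of_lt (by omega) hik (by omega)]
  · rcases (Nat.succ_le_of_lt h).eq_or_lt with rfl | h
    · rw [Nat.succ_eq_add_one, act_succ h1 hj', act_of_lt hj hik hj', act_succ h1 hj',
        act_of_lt h1 (by omega) (by omega)]
    rw [act_of_gt h1 h hj']
    rcases lt_trichotomy j k with h' | rfl | h'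
    · rw [act_of_lt hj h' hj', act_of_lt hj h' hj', act_of_gt h1 h hj', mul_assoc, mul_assoc,
        hs.comm i (k - 1) (by omega) (by omega)]
    · rw [act_self hj hj', act_self hj hj', map_add, map_smul,
        map_smul, act_of_gt h1 h hj', act_of_gt h1 (by omega) (by omega)]
    · rcases (Nat.succ_le_of_lt h').eq_or_lt with rfl | h'
      · rw [Nat.succ_eq_add_one, act_succ hk1 hj', act_succ hk1 hj',
          act_of_gt h1 (by omega) (by omega)]
      · rw [act_of_gt hk1 h' hj', act_of_gt hk1 h' hj', act_of_gt h1 h hj', mul_assoc, mul_assoc,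
          hs.comm i k hik (by omega)]

theorem act_braid {i : ℕ} (hs : IsTypeBHecke ζ (N - 1) s) (h1 : 1 ≤ i) (h2 : i + 1 < N) :
    act N ζ s τ μ i * act N ζ s τ μ (i + 1) * act N ζ s τ μ i =
      act N ζ s τ μ (i + 1) * act N ζ s τ μ i * act N ζ s τ μ (i + 1) := by
  refine ext_F fun j hj hj' z => ?_
  simp only [Module.End.mul_apply]
  have e1 := hs.braid i h1
  obtain ⟨a, rfl⟩ : ∃ a, i = a + 1 := ⟨i - 1, by omega⟩
  rcases lt_trichotomy j (a + 1) with h | rfl | h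
  · have h' : j < a + 1 + 1 := by omega
    simp only [act_of_lt hj h hj', act_of_lt hj h' hj', Nat.add_sub_cancel]
    rw [mul_assoc, mul_assoc, ← mul_assoc (s a), hs.braid a (by omega) (by omega)]
    simp only [mul_assoc]
  · have hl : ∀ z, act N ζ s τ μ (a + 1 + 1) (F N (a + 1) z) = F N (a + 1) (z * s (a + 1)) :=
      act_of_lt hj (Nat.lt_succ_self _) hj'
    have hq : z * s (a + 1) * s (a + 1) = (ζ - 1) • (z * s (a + 1)) + ζ • z := by
      rw [mul_assoc, hs.quad _ h1 (by omega), mul_add, mul_smul_comm, mul_smul_comm, mul_one]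
    simp only [act_self h1 hj', map_add, map_smul, hl,
      act_self (show 1 ≤ a + 1 + 1 by omega) h2.le, act_succ h1 h2.le,
      act_of_gt h1 (Nat.lt_succ_self (a + 1 + 1)) h2, hq]
    module
  · have hl : ∀ z, act N ζ s τ μ (a + 1 + 1) (F N (a + 1) z) = F N (a + 1) (z * s (a + 1)) :=
      act_of_lt h1 (Nat.lt_succ_self _) (by omega)
    have hg : ∀ z, act N ζ s τ μ (a + 1) (F N (a + 1 + 1 + 1) z) =
        F N (a + 1 + 1 + 1) (z * s (a + 1)) := act_of_gt h1 (Nat.lt_succ_self (a + 1 + 1)) h2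
    rcases (Nat.succ_le_of_lt h).eq_or_lt with rfl | h
    · simp only [Nat.succ_eq_add_one, act_succ h1 hj', hl,
        act_self h1 (show a + 1 ≤ N by omega), map_add, map_smul,
        act_self (show 1 ≤ a + 1 + 1 by omega) h2.le, hg,
        act_succ (show 1 ≤ a + 1 + 1 by omega) h2]
    rcases (Nat.succ_le_of_lt h).eq_or_lt with rfl | h
    · simp only [Nat.succ_eq_add_one, hg,
        act_succ (show 1 ≤ a + 1 + 1 by omega) h2, act_succ h1 h2.le, hl]
    · have h' : a + 1 + 1 < j := by omega
      have h'' : a + 1 + 1 + 1 < j := h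
      simp only [act_of_gt h1 h' hj', act_of_gt (show 1 ≤ a + 1 + 1 by omega) h'' hj']
      rw [mul_assoc, mul_assoc, ← mul_assoc (s (a + 1)), e1 (by omega)]
      simp only [mul_assoc]

theorem act_comm_zero (hζ : ζ ≠ 0) {i : ℕ} (hs : IsTypeBHecke ζ (N - 1) s)
    (hμ : IsEvaluation ζ (N - 1) s τ μ) (h1 : 1 < i) (h2 : i < N) :
    act N ζ s τ μ 0 * act N ζ s τ μ i = act N ζ s τ μ i * act N ζ s τ μ 0 := by
  refine ext_F fun j hj hj' z => ?_
  simp only [Module.End.mul_apply]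
  have hi1 : 1 ≤ i := by omega
  have hN : 1 ≤ N := by omega
  rcases hj.eq_or_lt with rfl | hj2
  · rw [act_zero_one hN, act_of_lt le_rfl h1 hN, act_of_lt le_rfl h1 hN, act_zero_one hN, mul_assoc,
      mul_assoc, hμ.central]
  rw [act_zero hj2 hj', map_add, map_smul, act_of_lt le_rfl h1 hN]
  rcases lt_trichotomy j i with h | rfl | h
  · rw [act_of_lt hj h hj', act_of_lt hj h hj', act_zero hj2 hj',
      hμ.mul_of_ne z (i - 1) (by omega) (by omega)]
    have e1 := hs.comm 0 (i - 1) (by omega) (by omega)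
    have e2 := (hs.commute_invProd (i := i - 1) (k := j - 2) (by omega) (by omega)).eq
    congr 2
    · rw [mul_assoc, mul_assoc, e1]
    · rw [← sub_mul, mul_assoc (μ z - z), e2, mul_assoc _ τ, ← hμ.central]
      simp only [mul_assoc]
  · rw [act_self hj hj', act_self hj hj', map_add, map_smul, map_smul, act_zero hj2 hj',
      act_zero (by omega) (by omega)]
    obtain ⟨k, rfl⟩ : ∃ k, j = k + 2 := ⟨j - 2, by omega⟩
    -- `s_i = (ζ - 1) + ζ s_i⁻¹`
    have e1 : invProd ζ s k * s (k + 1) = (ζ - 1) • invProd ζ s k + ζ • invProd ζ s (k + 1) := by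
      simp only [invProd, heckeInv, mul_sub, mul_smul_comm, mul_one]
      match_scalars <;> field_simp; ring
    have e2 : (μ z - z) * invProd ζ s k * τ * s (k + 1) =
        (ζ - 1) • ((μ z - z) * invProd ζ s k * τ) + ζ • ((μ z - z) * invProd ζ s (k + 1) * τ) := by
      rw [mul_assoc _ τ, ← hμ.central, ← mul_assoc, mul_assoc (μ z - z), e1]
      simp only [mul_add, add_mul, mul_smul_comm, smul_mul_assoc]
    simp only [Nat.add_sub_cancel, show k + 2 - 1 = k + 1 by omega,
      show k + 2 + 1 - 2 = k + 1 by omega, e2, map_add, map_smul]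
    module
  · rcases (Nat.succ_le_of_lt h).eq_or_lt with rfl | h
    · rw [Nat.succ_eq_add_one, act_succ hi1 hj', act_succ hi1 hj', act_zero h1 (by omega)]
      obtain ⟨k, rfl⟩ : ∃ k, i = k + 2 := ⟨i - 2, by omega⟩
      have e3 := hs.invProd_mul_self hζ (k := k) (by omega)
      simp only [Nat.add_sub_cancel, show k + 2 - 1 = k + 1 by omega,
        show k + 2 + 1 - 2 = k + 1 by omega]
      rw [mul_assoc _ τ, ← hμ.central, ← mul_assoc, mul_assoc (μ z - z) (invProd ζ s (k + 1)), e3]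
    · rw [act_of_gt hi1 h hj', act_of_gt hi1 h hj', act_zero hj2 hj',
        hμ.mul_of_ne z i (by omega) (by omega)]
      have e1 := hs.comm 0 i (by omega) (by omega)
      have e2 := hs.mul_invProd hζ (i := i) (k := j - 2) (by omega) (by omega) (by omega)
      congr 2
      · rw [mul_assoc, mul_assoc, e1]
      · rw [← sub_mul, mul_assoc (μ z - z), e2, mul_assoc _ τ, ← hμ.central]
        simp only [mul_assoc]

theorem act_braidB_one (hζ : ζ ≠ 0) (hμ : IsEvaluation ζ (N - 1) s τ μ) (hN : 1 < N) (z : E) :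
    act N ζ s τ μ 1 (act N ζ s τ μ 0 (act N ζ s τ μ 1 (act N ζ s τ μ 0 (F N 1 z)))) =
      act N ζ s τ μ 0 (act N ζ s τ μ 1 (act N ζ s τ μ 0 (act N ζ s τ μ 1 (F N 1 z)))) := by
  have hN1 : 1 ≤ N := hN.le
  have e2 : ∀ z, act N ζ s τ μ 1 (F N 2 z) = F N 1 z := act_succ (i := 1) le_rfl hN
  have e1 : ∀ z, act N ζ s τ μ 1 (F N 1 z) = (ζ - 1) • F N 1 z + ζ • F N 2 z :=
    act_self (i := 1) le_rfl hN1
  have e0 : ∀ z, act N ζ s τ μ 0 (F N 1 z) = F N 1 (z * τ) := act_zero_one hN1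
  have e02 : ∀ z, act N ζ s τ μ 0 (F N 2 z) = F N 2 (z * s 0) +
      (1 - ζ⁻¹) • (F N 1 (μ z * τ) - F N 1 (z * τ)) := fun z => by
    rw [act_zero le_rfl hN]; simp [invProd, sub_mul]
  have c1 : ∀ z, z * s 0 * τ = z * τ * s 0 := fun z => by
    rw [mul_assoc, mul_assoc, hμ.central]
  simp only [e0, e1, e2, e02, map_add, map_smul, map_sub, hμ.mul_var, hμ.idem, c1]
  match_scalars <;> field_simp <;> ring

theorem act_braidB_two (hζ : ζ ≠ 0) (hμ : IsEvaluation ζ (N - 1) s τ μ) (hN : 1 < N) (z : E) :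
    act N ζ s τ μ 1 (act N ζ s τ μ 0 (act N ζ s τ μ 1 (act N ζ s τ μ 0 (F N 2 z)))) =
      act N ζ s τ μ 0 (act N ζ s τ μ 1 (act N ζ s τ μ 0 (act N ζ s τ μ 1 (F N 2 z)))) := by
  have hN1 : 1 ≤ N := hN.le
  have e2 : ∀ z, act N ζ s τ μ 1 (F N 2 z) = F N 1 z := act_succ (i := 1) le_rfl hN
  have e1 : ∀ z, act N ζ s τ μ 1 (F N 1 z) = (ζ - 1) • F N 1 z + ζ • F N 2 z :=
    act_self (i := 1) le_rfl hN1
  have e0 : ∀ z, act N ζ s τ μ 0 (F N 1 z) = F N 1 (z * τ) := act_zero_one hN1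
  have e02 : ∀ z, act N ζ s τ μ 0 (F N 2 z) = F N 2 (z * s 0) +
      (1 - ζ⁻¹) • (F N 1 (μ z * τ) - F N 1 (z * τ)) := fun z => by
    rw [act_zero le_rfl hN]; simp [invProd, sub_mul]
  have c1 : ∀ z, z * s 0 * τ = z * τ * s 0 := fun z => by
    rw [mul_assoc, mul_assoc, hμ.central]
  simp only [e0, e1, e2, e02, map_add, map_smul, map_sub, hμ.mul_var, hμ.idem, c1]
  match_scalars <;> field_simp <;> ring

end HeckeModule

namespace HeckeModule

variable {N : ℕ} {E : Type*} [Ring E] [Algebra ℂ E] {ζ : ℂ} {s : ℕ → E} {τ : E} {μ : E →ₗ[ℂ] E}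

/-- Up to the factor `s_1⁻¹`, the product `s_1⁻¹ ⋯ s_k⁻¹` involves only elements commuting with
`s_0`, so it passes through the evaluation. -/
theorem eval_mul_invProd (hζ : ζ ≠ 0) {n k : ℕ} (hs : IsTypeBHecke ζ n s)
    (hμ : IsEvaluation ζ n s τ μ) (h1 : 1 ≤ k) (hk : k < n) (z : E) :
    μ (z * (s 1 * invProd ζ s k)) = μ z * (s 1 * invProd ζ s k) := by
  induction k, h1 using Nat.le_induction generalizing z with
  | base => simp [invProd, hs.mul_heckeInv hζ le_rfl hk]
  | succ k h1 ih =>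
    have hi : ∀ w, μ (w * heckeInv ζ s (k + 1)) = μ w * heckeInv ζ s (k + 1) := fun w => by
      simp only [heckeInv, mul_sub, mul_smul_comm, map_sub, map_smul, mul_one,
        hμ.mul_of_ne w (k + 1) hk (by omega)]
    rw [invProd, ← mul_assoc (s 1), ← mul_assoc, hi, ih (by omega), mul_assoc]

theorem act_braidB_of_gt (hζ : ζ ≠ 0) (hs : IsTypeBHecke ζ (N - 1) s)
    (hμ : IsEvaluation ζ (N - 1) s τ μ) {j : ℕ} (hj : 2 < j) (hjN : j ≤ N) (z : E) :
    act N ζ s τ μ 1 (act N ζ s τ μ 0 (act N ζ s τ μ 1 (act N ζ s τ μ 0 (F N j z)))) =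
      act N ζ s τ μ 0 (act N ζ s τ μ 1 (act N ζ s τ μ 0 (act N ζ s τ μ 1 (F N j z)))) := by
  have hN1 : 1 ≤ N := by omega
  have hN2 : 1 < N - 1 := by omega
  have e2 : ∀ z, act N ζ s τ μ 1 (F N 2 z) = F N 1 z :=
    act_succ (i := 1) le_rfl (show 1 + 1 ≤ N by omega)
  have e1 : ∀ z, act N ζ s τ μ 1 (F N 1 z) = (ζ - 1) • F N 1 z + ζ • F N 2 z :=
    act_self (i := 1) le_rfl hN1
  have e0 : ∀ z, act N ζ s τ μ 0 (F N 1 z) = F N 1 (z * τ) := act_zero_one hN1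
  have e02 : ∀ z, act N ζ s τ μ 0 (F N 2 z) = F N 2 (z * s 0) +
      (1 - ζ⁻¹) • (F N 1 (μ z * τ) - F N 1 (z * τ)) := fun z => by
    rw [act_zero le_rfl (by omega)]; simp [invProd, sub_mul]
  have e3 : ∀ z, act N ζ s τ μ 1 (F N j z) = F N j (z * s 1) := act_of_gt le_rfl hj hjN
  obtain ⟨D, hD⟩ : ∃ D, D = s 1 * invProd ζ s (j - 2) := ⟨_, rfl⟩
  have hd : ∀ w, w * invProd ζ s (j - 2) = ζ⁻¹ • (w * s 1 * D) - (1 - ζ⁻¹) • (w * D) := by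
    intro w
    have : invProd ζ s (j - 2) = heckeInv ζ s 1 * D := by
      rw [hD, ← mul_assoc, hs.heckeInv_mul hζ le_rfl hN2, one_mul]
    rw [this, heckeInv]
    simp only [sub_mul, mul_sub, smul_mul_assoc, mul_smul_comm, mul_assoc, one_mul]
  have hμD : ∀ w, μ (w * D) = μ w * D := fun w => by
    rw [hD]; exact eval_mul_invProd hζ hs hμ (by omega) (by omega) w
  have hDs : ∀ w, w * D * s 0 = w * s 0 * D := fun w => by
    rw [mul_assoc, mul_assoc, hD, (hs.commute_zero_mul_invProd hζ (by omega) (by omega)).eq]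
  have hq : ∀ w, w * s 1 * s 1 = (ζ - 1) • (w * s 1) + ζ • w := fun w => by
    rw [mul_assoc, hs.quad 1 le_rfl hN2, mul_add, mul_smul_comm, mul_smul_comm, mul_one]
  have hB : ∀ w, w * s 0 * s 1 * s 0 * s 1 = w * s 1 * s 0 * s 1 * s 0 := fun w => by
    have := congrArg (w * ·) (hs.braidB hN2)
    simpa only [← mul_assoc] using this
  have c : ∀ w b : E, w * τ * b = w * b * τ := fun w b => by
    rw [mul_assoc, mul_assoc, hμ.central]
  have hμ1 : ∀ w, μ (μ w * s 1) = μ w * s 1 := fun w => hμ.idem_mul w hN2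
  have hμc : ∀ w, μ (w * s 1 * s 0 * s 1) = μ w * s 1 * s 0 * s 1 := fun w => by
    simpa only [← mul_assoc] using hμ.mul_conj w hN2
  have hx : ∀ w, μ (w * s 0 * s 1) * s 1 =
      μ (w * s 1) * s 1 * s 0 - (ζ - 1) • (μ w * s 1 * s 0 - μ (w * s 0 * s 1)) := fun w => by
    rw [hμ.exchange w hN2]; abel
  have ej0 : ∀ z, act N ζ s τ μ 0 (F N j z) = F N j (z * s 0) + (1 - ζ⁻¹) •
      (ζ⁻¹ • F N 1 (μ z * s 1 * D * τ) - (1 - ζ⁻¹) • F N 1 (μ z * D * τ) -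
        (ζ⁻¹ • F N 1 (z * s 1 * D * τ) - (1 - ζ⁻¹) • F N 1 (z * D * τ))) := fun z => by
    rw [act_zero hj.le hjN, hd]
    simp only [sub_mul, smul_mul_assoc, map_sub, map_smul, smul_sub]
    abel
  simp only [e0, e1, e2, e02, e3, ej0, map_add, map_smul, map_sub, hμ.mul_var, hμ.idem, hμD,
    hμ1, hμc, hDs, c, hq, hB, hx, add_mul, sub_mul, smul_mul_assoc]
  match_scalars <;> field_simp <;> ring

end HeckeModule

/-! ### The polynomial relation on the module -/

/-- If `A` acts on `f(z)` as right multiplication of `z` by `b`, then so does every polynomial. The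
predicate `p` allows for a hypothesis on `z` that is stable under this multiplication. -/
theorem Polynomial.aeval_apply_of_forall {V E : Type*} [AddCommGroup V] [Module ℂ V] [Ring E]
    [Algebra ℂ E] {A : Module.End ℂ V} {f : E →ₗ[ℂ] V} {b : E} {p : E → Prop}
    (hp : ∀ z, p z → p (z * b)) (h : ∀ z, p z → A (f z) = f (z * b)) (P : Polynomial ℂ) {z : E}
    (hz : p z) : Polynomial.aeval A P (f z) = f (z * Polynomial.aeval b P) := by
  have key : ∀ n : ℕ, p (z * b ^ n) ∧ (A ^ n) (f z) = f (z * b ^ n) := by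
    intro n
    induction n with
    | zero => simpa using hz
    | succ n ih =>
      rw [pow_succ b, ← mul_assoc]
      exact ⟨hp _ ih.1, by rw [pow_succ', Module.End.mul_apply, ih.2, h _ ih.1]⟩
  induction P using Polynomial.induction_on' with
  | add P Q hP hQ => simp only [map_add, LinearMap.add_apply, hP, hQ, mul_add]
  | monomial n a =>
    simp [Polynomial.aeval_monomial, ← Algebra.smul_def, (key n).2, map_smul]

namespace HeckeModule

variable {N : ℕ} {E : Type*} [Ring E] [Algebra ℂ E] {ζ : ℂ} {s : ℕ → E} {τ : E} {μ : E →ₗ[ℂ] E}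

theorem isTypeBHecke_act (hζ : ζ ≠ 0) (hs : IsTypeBHecke ζ (N - 1) s)
    (hμ : IsEvaluation ζ (N - 1) s τ μ) : IsTypeBHecke ζ N (act N ζ s τ μ) where
  quad _ h1 h2 := act_quad hs h1 h2
  comm i j hij hj := by
    rcases Nat.eq_zero_or_pos i with rfl | hi
    · exact act_comm_zero hζ hs hμ hij hj
    · exact act_comm_pos hs hi hij hj
  braid _ h1 h2 := act_braid hs h1 h2
  braidB hN := by
    refine (ext_F fun j h1 h2 z => ?_).symm
    simp only [Module.End.mul_apply]
    rcases h1.eq_or_lt with rfl | h3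
    · exact act_braidB_one hζ hμ hN z
    rcases Nat.eq_or_lt_of_le h3 with rfl | h3
    · exact act_braidB_two hζ hμ hN z
    · exact act_braidB_of_gt hζ hs hμ h3 h2 z

/-- The polynomial relation. On `F_1` the element `T_0` acts as `τ`; on `F_2(z)`, with `z` fixed by
`μ`, as `s_0`. The product `T_1 T_0 T_1`, which commutes with `T_0`, carries this to all `F_2(z)`, and
the `T_j` with `j ≥ 2`, which also commute with `T_0`, carry it to the other `F_j(z)`. -/
theorem aeval_act_zero (hζ : ζ ≠ 0) (hs : IsTypeBHecke ζ (N - 1) s)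
    (hμ : IsEvaluation ζ (N - 1) s τ μ) (hN : 2 ≤ N) {P : Polynomial ℂ}
    (hPs : Polynomial.aeval (s 0) P = 0) (hPτ : Polynomial.aeval τ P = 0)
    (hE : ∀ p : Submodule ℂ E, (∀ z, μ z = z → z ∈ p) → (∀ z ∈ p, z * τ ∈ p) → p = ⊤) :
    Polynomial.aeval (act N ζ s τ μ 0) P = 0 := by
  have hB := isTypeBHecke_act hζ hs hμ
  set Q := Polynomial.aeval (act N ζ s τ μ 0) P with hQ
  have hN1 : 1 ≤ N := by omega
  have hcomm : ∀ {g}, Commute (act N ζ s τ μ 0) g → ∀ m, Q (g m) = g (Q m) := fun hg m => by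
    have : Commute Q _ := (Algebra.commute_of_mem_adjoin_singleton_of_commute
      (Polynomial.aeval_mem_adjoin_singleton ℂ _) hg.symm).symm
    exact LinearMap.congr_fun this.eq m
  have h1 : ∀ z, Q (F N 1 z) = 0 := fun z => by
    rw [hQ, Polynomial.aeval_apply_of_forall (p := fun _ => True) (fun _ _ => trivial)
      (fun z _ => act_zero_one hN1 z) P trivial, hPτ, mul_zero, map_zero]
  have h2 : ∀ z, Q (F N 2 z) = 0 := by
    have hp := hE (LinearMap.ker (Q ∘ₗ F N 2)) ?_ ?_
    · intro z
      have : z ∈ LinearMap.ker (Q ∘ₗ F N 2) := by rw [hp]; trivial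
      exact this
    · intro z hz
      rw [LinearMap.mem_ker, LinearMap.comp_apply, hQ,
        Polynomial.aeval_apply_of_forall (p := fun z => μ z = z) (b := s 0) _ _ P hz,
        hPs, mul_zero, map_zero]
      · intro z hz
        rw [hμ.mul_of_ne z 0 (by omega) (by omega), hz]
      · intro z hz
        rw [act_zero le_rfl hN, hz]
        simp
    · intro z hz
      rw [LinearMap.mem_ker, LinearMap.comp_apply] at hz ⊢
      have hc : Commute (act N ζ s τ μ 0) (act N ζ s τ μ 1 * act N ζ s τ μ 0 * act N ζ s τ μ 1) := by
        have := hB.braidB hN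
        rw [commute_iff_eq]
        simpa only [← mul_assoc] using this
      have := hcomm hc (F N 2 z)
      rw [hz, map_zero] at this
      simp only [Module.End.mul_apply] at this
      rw [show act N ζ s τ μ 1 (F N 2 z) = F N 1 z from act_succ (i := 1) le_rfl hN z,
        act_zero_one hN1, act_self le_rfl hN1, map_add, map_smul, map_smul, h1, smul_zero,
        zero_add, smul_eq_zero] at this
      exact this.resolve_left hζ
  refine ext_F fun j hj hjN z => ?_
  rw [LinearMap.zero_apply]
  rcases hj.eq_or_lt with rfl | hj
  · exact h1 z
  induction j, hj using Nat.le_induction generalizing z with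
  | base => exact h2 z
  | succ j hj ih =>
    have hj1 : 1 ≤ j := by omega
    have h3 := hcomm (hB.commute (i := 0) (j := j) (Or.inl (by omega)) (by omega) (by omega))
      (F N (j + 1) z)
    rw [act_succ hj1 hjN, ih (by omega) (by omega)] at h3
    have h4 := congrArg (fun m => heckeInv ζ (act N ζ s τ μ) j m) h3
    rwa [map_zero, ← Module.End.mul_apply, hB.heckeInv_mul hζ hj1 (by omega),
      Module.End.one_apply, eq_comm] at h4

end HeckeModule

theorem IsTypeBHecke.op {ζ : ℂ} {N : ℕ} {R : Type*} [Ring R] [Algebra ℂ R] {t : ℕ → R}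
    (h : IsTypeBHecke ζ N t) : IsTypeBHecke ζ N fun i => MulOpposite.op (t i) where
  quad i h1 h2 := congrArg MulOpposite.op (h.quad i h1 h2)
  comm i j hij hj := congrArg MulOpposite.op (h.comm i j hij hj).symm
  braid i h1 h2 := MulOpposite.unop_injective (by simpa [mul_assoc] using h.braid i h1 h2)
  braidB hN := MulOpposite.unop_injective (by simpa [mul_assoc] using (h.braidB hN).symm)

/-! ### The exchange rule -/

section Exchange

variable {ζ : ℂ} {R : Type*} [Ring R] [Algebra ℂ R]

/-- How `x` passes `T y T` for a polynomial `y` in `x`. -/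
theorem exchange_of_aeval (hζ : ζ ≠ 0) {T x : R} (hq : T * T = (ζ - 1) • T + ζ • (1 : R))
    (hB : x * T * x * T = T * x * T * x) (P : Polynomial ℂ) :
    T * Polynomial.aeval x P * T * x = x * T * Polynomial.aeval x P * T +
      (ζ - 1) • (Polynomial.aeval x P * T * x - x * T * Polynomial.aeval x P) := by
  have hTT : ∀ a : R, a * T * T = (ζ - 1) • (a * T) + ζ • a := fun a => by
    rw [mul_assoc, hq, mul_add, mul_smul_comm, mul_smul_comm, mul_one]
  -- `T` is invertible, as `ζ ≠ 0`
  have hcancel : ∀ a b : R, a * T = b * T → a = b := by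
    intro a b hab
    have := hTT a
    rw [hab, hTT b] at this
    exact (smul_right_injective R hζ (add_left_cancel this)).symm
  have key : ∀ n : ℕ, T * x ^ n * T * x = x * T * x ^ n * T +
      (ζ - 1) • (x ^ n * T * x - x * T * x ^ n) := by
    intro n
    induction n with
    | zero =>
      simp only [pow_zero, mul_one, one_mul, hTT, hq, add_mul, smul_mul_assoc]
      module
    | succ n ih =>
      have hB' : ∀ a : R, a * T * x * T * x = a * x * T * x * T := fun a => by
        simpa only [mul_assoc] using congrArg (a * ·) hB.symm
      have h2 := congrArg (fun y => y * T * x * T) ih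
      simp only [add_mul, sub_mul, smul_mul_assoc, hB', hTT] at h2
      -- by the induction hypothesis the two sides agree after multiplication by `T²` from the right
      refine hcancel _ _ (hcancel _ _ ?_)
      simp only [pow_succ, ← mul_assoc, add_mul, sub_mul, smul_mul_assoc, hTT]
      linear_combination (norm := module) h2
  induction P using Polynomial.induction_on' with
  | add P Q hP hQ =>
    simp only [map_add, mul_add, add_mul, hP, hQ]
    module
  | monomial n a =>
    simp only [Polynomial.aeval_monomial, ← Algebra.smul_def, mul_smul_comm, smul_mul_assoc, key n]
    module

end Exchange

/-! ### Polynomial coefficients -/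

namespace HeckeModule

open Polynomial

variable {A : Type*} [Ring A] [Algebra ℂ A] {ζ : ℂ} {n : ℕ} {t : ℕ → A} {P : ℂ[X]}

/-- Evaluation of `ℂ[X]/(P)` at an element `x` with `P(x) = 0`. -/
noncomputable def evalRoot (P : ℂ[X]) (x : A) (h : aeval x P = 0) : AdjoinRoot P →ₐ[ℂ] A :=
  Ideal.Quotient.liftₐ _ (aeval x) fun a ha => by
    obtain ⟨b, rfl⟩ := Ideal.mem_span_singleton'.1 ha
    rw [map_mul, h, mul_zero]

theorem evalRoot_mk {x : A} (h : aeval x P = 0) (q : ℂ[X]) :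
    evalRoot P x h (AdjoinRoot.mk P q) = aeval x q := rfl

theorem commute_evalRoot {x y : A} (h : aeval x P = 0) (hxy : Commute y x) (b : AdjoinRoot P) :
    Commute y (evalRoot P x h b) := by
  obtain ⟨q, rfl⟩ := AdjoinRoot.mk_surjective b
  exact Algebra.commute_of_mem_adjoin_singleton_of_commute
      (Polynomial.aeval_mem_adjoin_singleton ℂ _) hxy

/-- The map `a ⊗ q ↦ a q(x) ⊗ 1`. -/
noncomputable def evalTensor (P : ℂ[X]) (x : A) (h : aeval x P = 0) :
    A ⊗[ℂ] AdjoinRoot P →ₗ[ℂ] A ⊗[ℂ] AdjoinRoot P :=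
  (Algebra.TensorProduct.includeLeft (R := ℂ) (S := ℂ)).toLinearMap ∘ₗ LinearMap.mul' ℂ A ∘ₗ
    LinearMap.lTensor A (evalRoot P x h).toLinearMap

theorem evalTensor_tmul {x : A} (h : aeval x P = 0) (a : A) (b : AdjoinRoot P) :
    evalTensor P x h (a ⊗ₜ b) = (a * evalRoot P x h b) ⊗ₜ 1 := rfl

theorem isEvaluation_evalTensor (hζ : ζ ≠ 0) (ht : IsTypeBHecke ζ n t) (h : aeval (t 0) P = 0) :
    IsEvaluation ζ n (fun i => t i ⊗ₜ[ℂ] (1 : AdjoinRoot P)) (1 ⊗ₜ AdjoinRoot.root P)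
      (evalTensor P (t 0) h) where
  central z := by
    induction z with
    | zero => simp
    | add x y hx hy => rw [add_mul, mul_add, hx, hy]
    | tmul a b => simp [mul_comm]
  mul_var z := by
    induction z with
    | zero => simp
    | add x y hx hy => rw [add_mul, map_add, map_add, hx, hy, add_mul]
    | tmul a b =>
      have : evalRoot P (t 0) h (AdjoinRoot.root P) = t 0 :=
        (evalRoot_mk h X).trans (aeval_X _)
      simp [evalTensor_tmul, this, mul_assoc]
  mul_of_ne z i hi hi1 := by
    have hc : Commute (t i) (t 0) := by
      rcases Nat.eq_zero_or_pos i with rfl | hi0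
      · exact Commute.refl _
      · exact ht.commute (Or.inr (by omega)) hi (by omega)
    induction z with
    | zero => simp
    | add x y hx hy => rw [add_mul, map_add, map_add, hx, hy, add_mul]
    | tmul a b => simp [evalTensor_tmul, mul_assoc, (commute_evalRoot h hc b).eq]
  mul_conj z hn := by
    have hc : Commute (t 1 * t 0 * t 1) (t 0) := by
      rw [commute_iff_eq, ← ht.braidB hn]
      simp only [mul_assoc]
    induction z with
    | zero => simp
    | add x y hx hy => rw [add_mul, map_add, map_add, hx, hy, add_mul]
    | tmul a b =>
      have := (commute_evalRoot h hc b).eq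
      simp only [Algebra.TensorProduct.tmul_mul_tmul, mul_one, evalTensor_tmul]
      rw [mul_assoc a, this, ← mul_assoc a]
  idem z := by
    induction z with
    | zero => simp
    | add x y hx hy => simp only [map_add, hx, hy]
    | tmul a b => simp [evalTensor_tmul]
  idem_mul z _ := by
    induction z with
    | zero => simp
    | add x y hx hy => simp only [map_add, add_mul, hx, hy]
    | tmul a b => simp [evalTensor_tmul]
  exchange z hn := by
    induction z with
    | zero => simp
    | add x y hx hy =>
      simp only [map_add, add_mul, hx, hy]
      module
    | tmul a b =>
      obtain ⟨q, rfl⟩ := AdjoinRoot.mk_surjective b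
      have := exchange_of_aeval hζ (ht.quad 1 le_rfl hn) (ht.braidB hn) q
      simp only [Algebra.TensorProduct.tmul_mul_tmul, mul_one, evalTensor_tmul, evalRoot_mk]
      rw [← TensorProduct.sub_tmul, TensorProduct.smul_tmul', ← TensorProduct.add_tmul]
      congr 1
      simp only [mul_assoc, ← mul_sub, ← mul_smul_comm, ← mul_add] at this ⊢
      rw [this]

end HeckeModule

namespace CyclotomicHecke

open Polynomial HeckeModule

/-- The polynomial `(X - v_1) ⋯ (X - v_ℓ)`. -/
noncomputable def cycloPoly {ℓ : ℕ} (v : Fin ℓ → ℂ) : ℂ[X] :=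
  (List.ofFn fun p : Fin ℓ => (Polynomial.X : ℂ[X]) - C (v p)).prod

theorem aeval_cycloPoly {ℓ : ℕ} (v : Fin ℓ → ℂ) {R : Type*} [Ring R] [Algebra ℂ R] (x : R) :
    aeval x (cycloPoly v) = (List.ofFn fun p : Fin ℓ => x - algebraMap ℂ R (v p)).prod := by
  rw [cycloPoly, map_list_prod, List.map_ofFn]
  congr 2
  funext p
  simp

theorem cycloPoly_monic {ℓ : ℕ} (v : Fin ℓ → ℂ) : (cycloPoly v).Monic := by
  rw [cycloPoly, List.prod_ofFn]
  exact monic_prod_of_monic _ _ fun p _ => monic_X_sub_C _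

theorem cycloPoly_natDegree {ℓ : ℕ} (v : Fin ℓ → ℂ) : (cycloPoly v).natDegree = ℓ := by
  rw [cycloPoly, List.prod_ofFn, natDegree_prod_of_monic _ _ fun p _ => monic_X_sub_C _]
  simp

end CyclotomicHecke

/-! ### The lower bound for the dimension -/

namespace HeckeModule

open Polynomial

variable {A : Type*} [Ring A] [Algebra ℂ A] {ζ : ℂ} {n : ℕ} {t : ℕ → A} {P : ℂ[X]}

theorem tmul_one_mul_pow (a : A) (k : ℕ) :
    a ⊗ₜ[ℂ] (1 : AdjoinRoot P) * (1 ⊗ₜ AdjoinRoot.root P) ^ k = a ⊗ₜ (AdjoinRoot.root P ^ k) := by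
  rw [Algebra.TensorProduct.tmul_pow, one_pow, Algebra.TensorProduct.tmul_mul_tmul, mul_one,
    one_mul]

theorem eq_top_of_mul_root_mem {p : Submodule ℂ (A ⊗[ℂ] AdjoinRoot P)}
    (h1 : ∀ a : A, a ⊗ₜ 1 ∈ p) (h2 : ∀ z ∈ p, z * (1 ⊗ₜ AdjoinRoot.root P) ∈ p) : p = ⊤ := by
  have h3 : ∀ (a : A) (k : ℕ), a ⊗ₜ (AdjoinRoot.root P ^ k) ∈ p := by
    intro a k
    rw [← tmul_one_mul_pow]
    induction k with
    | zero => simpa using h1 a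
    | succ k ih => rw [pow_succ, ← mul_assoc]; exact h2 _ ih
  rw [eq_top_iff]
  rintro z -
  induction z with
  | zero => exact zero_mem _
  | add x y hx hy => exact add_mem hx hy
  | tmul a b =>
    obtain ⟨q, rfl⟩ := AdjoinRoot.mk_surjective b
    induction q using Polynomial.induction_on' with
    | add q r hq hr => rw [map_add, TensorProduct.tmul_add]; exact add_mem hq hr
    | monomial k c =>
      have := p.smul_mem c (h3 a k)
      rw [← TensorProduct.tmul_smul] at this
      convert this using 2
      rw [← Polynomial.smul_X_eq_monomial, ← AdjoinRoot.mk_X, ← map_pow, AdjoinRoot.smul_mk]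

/-- The vector `F_N(1)` generates the module: multiplication by the `T_i` with `i < N - 1` yields all
`F_N(a)`, then multiplication by `T_{N-1}, …, T_1` yields all `F_1(a)`, powers of `T_0` yield all
`F_1(z)`, and inverses of the `T_j` yield all `F_j(z)`. -/
theorem eq_top_of_act_mem (hζ : ζ ≠ 0) (hn : 1 ≤ n)
    (h : aeval (t 0) P = 0) (hgen : Algebra.adjoin ℂ (t '' Set.Iio n) = ⊤)
    {p : Submodule ℂ (Fin (n + 1) → A ⊗[ℂ] AdjoinRoot P)} (h1 : F (n + 1) (n + 1) 1 ∈ p)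
    (h2 : ∀ m ∈ p, ∀ i < n + 1, act (n + 1) ζ (fun i => t i ⊗ₜ[ℂ] (1 : AdjoinRoot P))
      (1 ⊗ₜ AdjoinRoot.root P) (evalTensor P (t 0) h) i m ∈ p) : p = ⊤ := by
  have hN : ∀ a : A, F (n + 1) (n + 1) (a ⊗ₜ[ℂ] (1 : AdjoinRoot P)) ∈ p := by
    intro a
    let q : Submodule ℂ A := p.comap (F (n + 1) (n + 1) ∘ₗ
      (Algebra.TensorProduct.includeLeft (R := ℂ) (S := ℂ) (B := AdjoinRoot P)).toLinearMap)
    have hq : ∀ b ∈ q, ∀ g ∈ t '' Set.Iio n, b * g ∈ q := by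
      rintro b hb _ ⟨i, hi, rfl⟩
      rw [Set.mem_Iio] at hi
      have h3 := h2 _ hb i (by omega)
      rw [LinearMap.comp_apply, AlgHom.toLinearMap_apply,
        Algebra.TensorProduct.includeLeft_apply] at h3
      change F (n + 1) (n + 1) ((b * t i) ⊗ₜ[ℂ] (1 : AdjoinRoot P)) ∈ p
      rcases Nat.eq_zero_or_pos i with rfl | hi0
      · rw [act_zero (by omega) le_rfl, evalTensor_tmul] at h3
        simpa using h3
      · rw [act_of_gt hi0 (by omega) le_rfl] at h3
        simpa using h3
    have ha : a ∈ Algebra.adjoin ℂ (t '' Set.Iio n) := by rw [hgen]; trivial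
    have h1q : (1 : A) ∈ q := h1
    have : 1 * a ∈ q := Submodule.mul_mem_of_mem_adjoin hq h1q ha
    rwa [one_mul] at this
  have hdown : ∀ k ≤ n, ∀ a : A, F (n + 1) (n + 1 - k) (a ⊗ₜ[ℂ] (1 : AdjoinRoot P)) ∈ p := by
    intro k hk a
    induction k with
    | zero => exact hN a
    | succ k ih =>
      have h3 := h2 _ (ih (by omega)) (n - k) (by omega)
      rw [show n + 1 - k = n - k + 1 by omega, act_succ (by omega) (by omega)] at h3
      rwa [show n + 1 - (k + 1) = n - k by omega]
  have hF1 : p.comap (F (n + 1) 1) = ⊤ := by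
    refine eq_top_of_mul_root_mem (fun a => ?_) fun z hz => ?_
    · simpa using hdown n le_rfl a
    · have h3 := h2 _ hz 0 (by omega)
      rwa [act_zero_one (by omega)] at h3
  have hF : ∀ j, 1 ≤ j → j ≤ n + 1 → ∀ z : A ⊗[ℂ] AdjoinRoot P, F (n + 1) j z ∈ p := by
    intro j hj hjn z
    induction j, hj using Nat.le_induction with
    | base =>
      have : z ∈ p.comap (F (n + 1) 1) := by rw [hF1]; trivial
      exact this
    | succ j hj ih =>
      have h3 := h2 _ (ih (by omega)) j (by omega)
      rw [act_self hj (by omega)] at h3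
      have h4 := (Submodule.add_mem_iff_right p (p.smul_mem _ (ih (by omega)))).1 h3
      exact (p.smul_mem_iff hζ).1 h4
  rw [← Submodule.ker_mkQ p, LinearMap.ker_eq_top]
  refine ext_F fun j h1 h2 z => ?_
  simpa using hF j h1 h2 z

end HeckeModule

namespace CyclotomicHecke

open Polynomial HeckeModule

/-- The map `h ↦ F_N(1) h` is a surjection from `H(Γ_N)`, here with `N = n + 1`, to the module. -/
theorem le_finrank (ζ : ℂ) (hζ : ζ ≠ 0) {ℓ : ℕ} (v : Fin ℓ → ℂ) {n : ℕ} (hn : 1 ≤ n)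
    [Module.Finite ℂ (CyclotomicHecke ζ v n)] [Module.Finite ℂ (CyclotomicHecke ζ v (n + 1))] :
    (n + 1) * (Module.finrank ℂ (CyclotomicHecke ζ v n) * ℓ) ≤
      Module.finrank ℂ (CyclotomicHecke ζ v (n + 1)) := by
  have ht : IsTypeBHecke ζ n (T ζ v n) := isTypeBHecke_T ζ v
  have hP : aeval (T ζ v n 0) (cycloPoly v) = 0 := by
    rw [aeval_cycloPoly]; exact prod_T_zero_sub ζ v hn
  set A := CyclotomicHecke ζ v n
  set P := cycloPoly v with hPdef
  set s : ℕ → A ⊗[ℂ] AdjoinRoot P := fun i => T ζ v n i ⊗ₜ 1 with hs_def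
  set τ : A ⊗[ℂ] AdjoinRoot P := 1 ⊗ₜ AdjoinRoot.root P with hτ_def
  set μ := evalTensor P (T ζ v n 0) hP with hμ_def
  have hs : IsTypeBHecke ζ (n + 1 - 1) s :=
    ht.map (Algebra.TensorProduct.includeLeft (R := ℂ) (S := ℂ) (A := A) (B := AdjoinRoot P))
  have hμ : IsEvaluation ζ (n + 1 - 1) s τ μ := isEvaluation_evalTensor hζ ht hP
  have hact := isTypeBHecke_act (N := n + 1) hζ hs hμ
  have hQ : aeval (act (n + 1) ζ s τ μ 0) P = 0 := by
    refine aeval_act_zero hζ hs hμ (by omega) ?_ ?_ fun p h1 h2 =>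
      eq_top_of_mul_root_mem (fun a => h1 _ ?_) h2
    · change aeval (Algebra.TensorProduct.includeLeft (R := ℂ) (S := ℂ) (B := AdjoinRoot P)
        (T ζ v n 0)) P = 0
      rw [aeval_algHom_apply, hP, map_zero]
    · change aeval (Algebra.TensorProduct.includeRight (R := ℂ) (A := A) (AdjoinRoot.root P)) P = 0
      rw [aeval_algHom_apply, AdjoinRoot.aeval_eq, AdjoinRoot.mk_self, map_zero]
    · rw [hμ_def, evalTensor_tmul, map_one, mul_one]
  obtain ⟨f, hf0, hf⟩ := exists_lift hζ v hact.op fun _ => by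
    rw [← aeval_cycloPoly, aeval_op_apply, hQ, MulOpposite.op_zero]
  let Ψ : CyclotomicHecke ζ v (n + 1) →ₗ[ℂ] (Fin (n + 1) → A ⊗[ℂ] AdjoinRoot P) :=
    { toFun := fun h => (f h).unop (F (n + 1) (n + 1) 1)
      map_add' := fun x y => by simp
      map_smul' := fun c x => by simp }
  have hsurj : Function.Surjective Ψ := by
    rw [← LinearMap.range_eq_top]
    refine eq_top_of_act_mem hζ hn hP (parabolic_Iio_self ζ v hζ) ⟨1, ?_⟩ ?_
    · simp [Ψ]
    rintro _ ⟨h, rfl⟩ i hi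
    refine ⟨h * T ζ v (n + 1) i, ?_⟩
    have : f (T ζ v (n + 1) i) = MulOpposite.op (act (n + 1) ζ s τ μ i) := by
      rcases Nat.eq_zero_or_pos i with rfl | hi0
      · exact hf0 (by omega)
      · exact hf i hi0 hi
    simp [Ψ, this]
    rfl
  have hfr : Module.finrank ℂ (Fin (n + 1) → A ⊗[ℂ] AdjoinRoot P) =
      (n + 1) * (Module.finrank ℂ A * ℓ) := by
    have : Module.finrank ℂ (AdjoinRoot P) = ℓ := by
      rw [(AdjoinRoot.powerBasis' (cycloPoly_monic v)).finrank, AdjoinRoot.powerBasis'_dim,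
        cycloPoly_natDegree]
    have hfin := (AdjoinRoot.powerBasis' (cycloPoly_monic v)).finite
    rw [Module.finrank_pi_fintype, Finset.sum_const, Module.finrank_tensorProduct, this]
    simp
  rw [← hfr]
  exact LinearMap.finrank_le_finrank_of_surjective hsurj

end CyclotomicHecke

/-! ### Descending products -/

/-- The product `t_{k-1} t_{k-2} ⋯ t_j` (equal to `1` if `k ≤ j`). -/
noncomputable def descProd {R : Type*} [Monoid R] (t : ℕ → R) (j k : ℕ) : R :=
  ((List.range' j (k - j)).reverse.map t).prod

section DescProd

variable {R : Type*} [Monoid R] {t : ℕ → R}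

theorem descProd_self (j : ℕ) : descProd t j j = 1 := by simp [descProd]

theorem descProd_succ_left {j k : ℕ} (h : j < k) :
    descProd t j k = descProd t (j + 1) k * t j := by
  rw [descProd, descProd, show k - j = (k - (j + 1)) + 1 by omega, List.range'_succ]
  simp

theorem descProd_succ_right {j k : ℕ} (h : j ≤ k) :
    descProd t j (k + 1) = t k * descProd t j k := by
  rw [descProd, descProd, show k + 1 - j = (k - j) + 1 by omega, List.range'_concat]
  simp [h]

theorem descProd_mul_descProd {i j k : ℕ} (hij : i ≤ j) (hjk : j ≤ k) :
    descProd t j k * descProd t i j = descProd t i k := by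
  induction k, hjk using Nat.le_induction with
  | base => rw [descProd_self, one_mul]
  | succ k hk ih => rw [descProd_succ_right hk, mul_assoc, ih, descProd_succ_right (by omega)]

theorem commute_descProd {a : R} {j k : ℕ} (h : ∀ i, j ≤ i → i < k → Commute a (t i)) :
    Commute a (descProd t j k) := by
  refine Commute.list_prod_right _ _ fun x hx => ?_
  simp only [List.mem_map, List.mem_reverse, List.mem_range'_1] at hx
  obtain ⟨i, hi, rfl⟩ := hx
  exact h i hi.1 (by omega)

end DescProd

theorem IsTypeBHecke.descProd_mul {ζ : ℂ} {N : ℕ} {R : Type*} [Ring R] [Algebra ℂ R] {t : ℕ → R}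
    (h : IsTypeBHecke ζ N t) {i j k : ℕ} (hj : 1 ≤ j) (hji : j < i) (hik : i < k) (hk : k ≤ N) :
    descProd t j k * t i = t (i - 1) * descProd t j k := by
  obtain ⟨i, rfl⟩ : ∃ a, i = a + 1 := ⟨i - 1, by omega⟩
  rw [Nat.add_sub_cancel]
  induction k, hik using Nat.le_induction with
  | base =>
    have hc : Commute (t (i + 1)) (descProd t j i) :=
      commute_descProd fun l _ h2 => h.commute (Or.inr (by omega)) (by omega) (by omega)
    rw [Nat.succ_eq_add_one, descProd_succ_right (by omega), descProd_succ_right (by omega),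
      mul_assoc, mul_assoc, ← hc.eq, ← mul_assoc, ← mul_assoc, ← h.braid i (by omega) (by omega)]
    simp only [mul_assoc]
  | succ k hik ih =>
    rw [descProd_succ_right (by omega), mul_assoc, ih (by omega), ← mul_assoc, ← mul_assoc,
      (h.commute (i := k) (j := i) (Or.inr (by omega)) (by omega) (by omega)).eq]

/-! ### Spanning families -/

/-- Moving a power of `x` through `T`, when `T x = y T - c y`. -/
theorem mul_pow_eq_of_mul_eq {R : Type*} [Ring R] [Algebra ℂ R] {T x y : R} {c : ℂ}
    (h : T * x = y * T - c • y) (p : ℕ) :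
    T * x ^ p = y ^ p * T - c • ∑ a ∈ Finset.range p, y ^ (a + 1) * x ^ (p - 1 - a) := by
  induction p with
  | zero => simp
  | succ p ih =>
    rw [pow_succ, ← mul_assoc, ih, sub_mul, mul_assoc, h, Finset.sum_range_succ, smul_mul_assoc,
      Finset.sum_mul]
    have : ∀ a ∈ Finset.range p, y ^ (a + 1) * x ^ (p - 1 - a) * x =
        y ^ (a + 1) * x ^ (p + 1 - 1 - a) := fun a ha => by
      rw [Finset.mem_range] at ha
      rw [mul_assoc, ← pow_succ, show p - 1 - a + 1 = p + 1 - 1 - a by omega]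
    rw [Finset.sum_congr rfl this, mul_sub, ← mul_assoc, ← pow_succ, mul_smul_comm]
    simp only [Nat.add_sub_cancel, Nat.sub_self, pow_zero, mul_one, ← pow_succ]
    module

theorem Subalgebra.mul_mem_span {R : Type*} [Ring R] [Algebra ℂ R] {K : Subalgebra ℂ R}
    {G : Set R} {a z : R} (ha : a ∈ K) (hz : z ∈ Submodule.span K G) :
    a * z ∈ Submodule.span K G :=
  (Submodule.span K G).smul_mem (⟨a, ha⟩ : K) hz

theorem Subalgebra.span_mul_mem {R : Type*} [Ring R] [Algebra ℂ R] {K : Subalgebra ℂ R}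
    {G : Set R} {p : Submodule K R} {t z : R} (h : ∀ g ∈ G, g * t ∈ p)
    (hz : z ∈ Submodule.span K G) : z * t ∈ p := by
  induction hz using Submodule.span_induction with
  | mem x hx => exact h x hx
  | zero => rw [zero_mul]; exact zero_mem _
  | add x y _ _ hx hy => rw [add_mul]; exact add_mem hx hy
  | smul a x _ hx => rw [smul_mul_assoc]; exact p.smul_mem a hx

theorem Subalgebra.mul_mem_of_mem_adjoin {R : Type*} [Ring R] [Algebra ℂ R] {K : Subalgebra ℂ R}
    {G S : Set R} (h : ∀ g ∈ G, ∀ t ∈ S, g * t ∈ Submodule.span K G) {z y : R}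
    (hz : z ∈ Submodule.span K G) (hy : y ∈ Algebra.adjoin ℂ S) : z * y ∈ Submodule.span K G :=
  Submodule.mul_mem_of_mem_adjoin (p := (Submodule.span K G).restrictScalars ℂ)
    (fun _ hz t ht => Subalgebra.span_mul_mem (fun g hg => h g hg t ht) hz) hz hy

namespace CyclotomicHecke

variable (ζ : ℂ) {ℓ : ℕ} (v : Fin ℓ → ℂ) {N : ℕ}

theorem T_mul_X (hζ : ζ ≠ 0) {i : ℕ} (h1 : 1 ≤ i) (h2 : i < N) :
    T ζ v N i * X ζ v N i = X ζ v N (i + 1) * T ζ v N i - (ζ - 1) • X ζ v N (i + 1) := by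
  have h3 := T_mul_X_mul_T ζ v (n := N) ⟨h1, h2⟩
  have h4 := congrArg (· * T ζ v N i) h3
  simp only [mul_assoc _ (T ζ v N i) (T ζ v N i), T_quad ζ v h1 h2, mul_add, mul_smul_comm, mul_one,
    smul_mul_assoc] at h4
  rw [h3] at h4
  have h5 : ζ • (T ζ v N i * X ζ v N i) =
      ζ • (X ζ v N (i + 1) * T ζ v N i - (ζ - 1) • X ζ v N (i + 1)) := by
    rw [smul_sub, ← h4]
    module
  exact smul_right_injective _ hζ h5

theorem T_mul_X_pow (hζ : ζ ≠ 0) {i : ℕ} (h1 : 1 ≤ i) (h2 : i < N) (p : ℕ) :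
    T ζ v N i * X ζ v N i ^ p = X ζ v N (i + 1) ^ p * T ζ v N i - (ζ - 1) •
      ∑ a ∈ Finset.range p, X ζ v N (i + 1) ^ (a + 1) * X ζ v N i ^ (p - 1 - a) :=
  mul_pow_eq_of_mul_eq (T_mul_X ζ v hζ h1 h2) p

theorem commute_T_X {i j : ℕ} (hi : i < N) (hj : 1 ≤ j ∧ j ≤ N) (h : i ≠ 0 → j ≠ i ∧ j ≠ i + 1) :
    Commute (T ζ v N i) (X ζ v N j) := by
  rcases Nat.eq_zero_or_pos i with rfl | h0
  · rw [T_zero]; exact X_comm ζ v ⟨le_rfl, by omega⟩ hj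
  · exact T_X_comm ζ v ⟨h0, hi⟩ hj (h (by omega)).1 (h (by omega)).2

variable (N) in
/-- The elements `T_{k-1} ⋯ T_j X_j^p`, `1 ≤ j ≤ k`, `0 ≤ p < ℓ`. -/
def descSet (k : ℕ) : Set (CyclotomicHecke ζ v N) :=
  {z | ∃ j p, 1 ≤ j ∧ j ≤ k ∧ p < ℓ ∧ z = descProd (T ζ v N) j k * X ζ v N j ^ p}

variable {ζ v}

theorem desc_mem {K : Subalgebra ℂ (CyclotomicHecke ζ v N)} {k j p : ℕ} (h1 : 1 ≤ j) (h2 : j ≤ k)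
    (hp : p < ℓ) :
    descProd (T ζ v N) j k * X ζ v N j ^ p ∈ Submodule.span K (descSet ζ v N k) :=
  Submodule.subset_span ⟨j, p, h1, h2, hp, rfl⟩

/-- The polynomial relation reduces `X_1^ℓ` to lower powers. -/
theorem X_one_pow_mem (hN : 1 ≤ N) {p : Submodule ℂ (CyclotomicHecke ζ v N)}
    {z : CyclotomicHecke ζ v N} (h : ∀ a < ℓ, z * X ζ v N 1 ^ a ∈ p) : z * X ζ v N 1 ^ ℓ ∈ p := by
  have h1 : Polynomial.aeval (X ζ v N 1) (cycloPoly v) = 0 := by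
    rw [aeval_cycloPoly, ← T_zero, prod_T_zero_sub ζ v hN]
  rw [Polynomial.aeval_eq_sum_range, cycloPoly_natDegree, Finset.sum_range_succ,
    show (cycloPoly v).coeff ℓ = 1 by
      have := cycloPoly_monic v
      rwa [Polynomial.Monic, Polynomial.leadingCoeff, cycloPoly_natDegree] at this,
    one_smul, add_comm, add_eq_zero_iff_eq_neg] at h1
  rw [h1, mul_neg, Finset.mul_sum]
  refine neg_mem (sum_mem fun a ha => ?_)
  rw [mul_smul_comm]
  exact p.smul_mem _ (h a (Finset.mem_range.1 ha))

theorem X_mem_of_T_mem (hζ : ζ ≠ 0) {K : Subalgebra ℂ (CyclotomicHecke ζ v N)} {i : ℕ}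
    (hi : 1 ≤ i ∧ i ≤ N) (hK : ∀ j < i, T ζ v N j ∈ K) : X ζ v N i ∈ K := by
  have h := X_mem ζ v hζ (n := N) (I := Set.Iio i) hi subset_rfl
  refine Algebra.adjoin_le ?_ h
  rintro _ ⟨j, hj, rfl⟩
  exact hK j hj

/-- Multiplication by `T_{j-1}` from the right lowers the index `j`. -/
theorem desc_mul_T_pred (hζ : ζ ≠ 0) {K : Subalgebra ℂ (CyclotomicHecke ζ v N)} {k : ℕ}
    (hk : k ≤ N) (hK : ∀ i, i + 1 < k → T ζ v N i ∈ K) {j p : ℕ} (h1 : 1 ≤ j) (h2 : j < k)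
    (hp : p < ℓ) : descProd (T ζ v N) (j + 1) k * X ζ v N (j + 1) ^ p * T ζ v N j ∈
      Submodule.span K (descSet ζ v N k) := by
  have h := T_mul_X_pow ζ v hζ h1 (h2.trans_le hk) p
  rw [eq_sub_iff_add_eq] at h
  rw [mul_assoc, ← h, mul_add, ← mul_assoc, ← descProd_succ_left h2, mul_smul_comm, Finset.mul_sum]
  refine add_mem (desc_mem h1 h2.le hp) (Submodule.smul_of_tower_mem _ _ (sum_mem fun a ha => ?_))
  rw [Finset.mem_range] at ha
  have hc : Commute (X ζ v N j) (descProd (T ζ v N) (j + 1) k) := commute_descProd fun i h3 h4 =>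
    (commute_T_X ζ v (by omega) ⟨h1, by omega⟩ (by omega)).symm
  have hX : Commute (X ζ v N j) (X ζ v N (j + 1)) :=
    X_comm ζ v ⟨h1, by omega⟩ ⟨by omega, by omega⟩
  have hm : X ζ v N j ∈ K :=
    X_mem_of_T_mem hζ ⟨h1, by omega⟩ fun i hi => hK i (by omega)
  rw [← mul_assoc, ← ((hc.mul_right (hX.pow_right (a + 1))).pow_left (p - 1 - a)).eq]
  exact Subalgebra.mul_mem_span (pow_mem hm _) (desc_mem (by omega) (by omega) (by omega))

/-- The left `K`-module spanned by the `T_{k-1} ⋯ T_j X_j^p` is stable under right multiplication by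
`T_0, …, T_{k-1}`. -/
theorem desc_mul_T (hζ : ζ ≠ 0) {K : Subalgebra ℂ (CyclotomicHecke ζ v N)} {k : ℕ}
    (hk : k ≤ N) (hK : ∀ i, i + 1 < k → T ζ v N i ∈ K) {g : CyclotomicHecke ζ v N}
    (hg : g ∈ descSet ζ v N k) {i : ℕ} (hi : i < k) :
    g * T ζ v N i ∈ Submodule.span K (descSet ζ v N k) := by
  obtain ⟨j, p, h1, h2, hp, rfl⟩ := hg
  have hB := isTypeBHecke_T ζ v (N := N)
  rcases Nat.eq_zero_or_pos i with rfl | hi0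
  · rcases h1.eq_or_lt with rfl | h1'
    · rw [T_zero, mul_assoc, ← pow_succ]
      rcases Nat.eq_or_lt_of_le (Nat.succ_le_of_lt hp) with hp' | hp'
      · rw [show p + 1 = ℓ from hp']
        exact X_one_pow_mem (p := (Submodule.span K (descSet ζ v N k)).restrictScalars ℂ)
          (by omega) fun a ha => desc_mem h1 h2 ha
      · exact desc_mem h1 h2 hp'
    · have hc : Commute (T ζ v N 0) (descProd (T ζ v N) j k * X ζ v N j ^ p) :=
        (commute_descProd fun l h3 h4 =>
          hB.commute (Or.inl (by omega)) (by omega) (by omega)).mul_right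
        ((commute_T_X ζ v (by omega) ⟨h1, by omega⟩ (by omega)).pow_right p)
      rw [← hc.eq]
      exact Subalgebra.mul_mem_span (hK 0 (by omega)) (desc_mem h1 h2 hp)
  rcases lt_trichotomy i j with hij | rfl | hij
  · rcases (Nat.succ_le_of_lt hij).eq_or_lt with rfl | hij
    · exact desc_mul_T_pred hζ hk hK hi0 hi hp
    · have hc : Commute (T ζ v N i) (descProd (T ζ v N) j k * X ζ v N j ^ p) :=
        (commute_descProd fun l h3 h4 =>
          hB.commute (Or.inl (by omega)) (by omega) (by omega)).mul_right
        ((commute_T_X ζ v (by omega) ⟨h1, by omega⟩ (by omega)).pow_right p)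
      rw [← hc.eq]
      exact Subalgebra.mul_mem_span (hK i (by omega)) (desc_mem h1 h2 hp)
  · -- move `X_i^p` to the left of `T_i`; the resulting products were treated before
    rw [descProd_succ_left hi, mul_assoc _ (T ζ v N i), T_mul_X_pow ζ v hζ hi0 (by omega),
      mul_sub, sub_mul, mul_smul_comm, smul_mul_assoc, Finset.mul_sum, Finset.sum_mul]
    refine sub_mem ?_ (Submodule.smul_of_tower_mem _ _ (sum_mem fun a ha => ?_))
    · rw [mul_assoc, mul_assoc, T_quad ζ v hi0 (by omega), mul_add, mul_add, mul_smul_comm,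
        mul_smul_comm, mul_smul_comm, mul_smul_comm, mul_one, ← mul_assoc]
      exact add_mem (Submodule.smul_of_tower_mem _ _ (desc_mul_T_pred hζ hk hK hi0 hi hp))
        (Submodule.smul_of_tower_mem _ _ (desc_mem (by omega) (by omega) hp))
    · rw [Finset.mem_range] at ha
      have hc : Commute (X ζ v N i) (descProd (T ζ v N) (i + 1) k) :=
        commute_descProd fun l h3 h4 =>
          (commute_T_X ζ v (by omega) ⟨h1, by omega⟩ (by omega)).symm
      have hX : Commute (X ζ v N i) (X ζ v N (i + 1)) :=
        X_comm ζ v ⟨h1, by omega⟩ ⟨by omega, by omega⟩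
      have hm : X ζ v N i ∈ K :=
        X_mem_of_T_mem hζ ⟨h1, by omega⟩ fun i hi => hK i (by omega)
      rw [← mul_assoc, ← ((hc.mul_right (hX.pow_right (a + 1))).pow_left (p - 1 - a)).eq, mul_assoc]
      exact Subalgebra.mul_mem_span (pow_mem hm _) (desc_mul_T_pred hζ hk hK hi0 hi (by omega))
  · have hc : Commute (T ζ v N i) (X ζ v N j ^ p) :=
      (commute_T_X ζ v (by omega) ⟨h1, by omega⟩ (by omega)).pow_right p
    rw [mul_assoc, ← hc.eq, ← mul_assoc, hB.descProd_mul h1 hij hi hk, mul_assoc]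
    exact Subalgebra.mul_mem_span (hK _ (by omega)) (desc_mem h1 h2 hp)

theorem one_mem_span_descSet (hℓ : 0 < ℓ) {K : Subalgebra ℂ (CyclotomicHecke ζ v N)} {k : ℕ}
    (hk : 1 ≤ k) : 1 ∈ Submodule.span K (descSet ζ v N k) := by
  have := desc_mem (ζ := ζ) (v := v) (K := K) hk le_rfl hℓ
  rwa [descProd_self, pow_zero, one_mul] at this

theorem subGamma_le_span (hℓ : 0 < ℓ) (hζ : ζ ≠ 0) {k : ℕ} (hk : k + 1 ≤ N)
    {x : CyclotomicHecke ζ v N} (hx : x ∈ subGamma ζ v N (k + 1)) :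
    x ∈ Submodule.span (subGamma ζ v N k) (descSet ζ v N (k + 1)) := by
  rw [← one_mul x]
  refine Subalgebra.mul_mem_of_mem_adjoin ?_ (one_mem_span_descSet hℓ (by omega)) hx
  rintro g hg _ ⟨i, hi, rfl⟩
  exact desc_mul_T hζ hk (fun j hj => T_mem ζ v (show j < k by omega)) hg hi

theorem descSet_finite (k : ℕ) : (descSet ζ v N k).Finite := by
  refine ((Set.finite_Icc 1 k).prod (Set.finite_Iio ℓ)).image
    (fun q => descProd (T ζ v N) q.1 k * X ζ v N q.1 ^ q.2) |>.subset ?_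
  rintro _ ⟨j, p, h1, h2, hp, rfl⟩
  exact ⟨(j, p), ⟨⟨h1, h2⟩, hp⟩, rfl⟩

theorem finite_subGamma (hℓ : 0 < ℓ) (hζ : ζ ≠ 0) {k : ℕ} (hk : k ≤ N) :
    Module.Finite ℂ (subGamma ζ v N k) := by
  induction k with
  | zero =>
    have : subGamma ζ v N 0 = ⊥ := by
      have : Set.Iio 0 = (∅ : Set ℕ) := by ext; simp
      rw [subGamma, parabolic, this, Set.image_empty, Algebra.adjoin_empty]
    rw [this]
    infer_instance
  | succ k ih =>
    have := ih (by omega)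
    have h1 : Module.Finite (subGamma ζ v N k)
        (Submodule.span (subGamma ζ v N k) (descSet ζ v N (k + 1))) :=
      Module.Finite.span_of_finite _ (descSet_finite _)
    have h2 : Module.Finite ℂ (Submodule.span (subGamma ζ v N k) (descSet ζ v N (k + 1))) :=
      Module.Finite.trans (subGamma ζ v N k) _
    have h3 : Module.Finite ℂ
        ((Submodule.span (subGamma ζ v N k) (descSet ζ v N (k + 1))).restrictScalars ℂ) := h2
    exact Submodule.finiteDimensional_of_le
      (S₁ := Subalgebra.toSubmodule (subGamma ζ v N (k + 1)))
      (S₂ := (Submodule.span (subGamma ζ v N k) (descSet ζ v N (k + 1))).restrictScalars ℂ)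
      fun x hx =>
        subGamma_le_span hℓ hζ hk hx

theorem finite (hℓ : 0 < ℓ) (hζ : ζ ≠ 0) : Module.Finite ℂ (CyclotomicHecke ζ v N) := by
  have := finite_subGamma (v := v) hℓ hζ (le_refl N)
  have h : subGamma ζ v N N = ⊤ := parabolic_Iio_self ζ v hζ
  rw [h] at this
  exact Module.Finite.equiv (Subalgebra.topEquiv (R := ℂ)).toLinearEquiv

end CyclotomicHecke

/-! ### Independence from dimensions -/

namespace CyclotomicHecke

variable {ζ : ℂ} {ℓ : ℕ} {v : Fin ℓ → ℂ} {N : ℕ}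

/-- The homomorphism `H(Γ_k) → H(Γ_N)`. -/
theorem exists_inclusion (hζ : ζ ≠ 0) {k : ℕ} (hk1 : 1 ≤ k) (hk : k ≤ N) :
    ∃ f : CyclotomicHecke ζ v k →ₐ[ℂ] CyclotomicHecke ζ v N,
      (∀ i < k, f (T ζ v k i) = T ζ v N i) ∧ f.range = subGamma ζ v N k := by
  obtain ⟨f, h0, h1⟩ := exists_lift hζ v ((isTypeBHecke_T ζ v (N := N)).mono hk)
    fun _ => prod_T_zero_sub ζ v (by omega)
  have h : ∀ i < k, f (T ζ v k i) = T ζ v N i := fun i hi => by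
    rcases Nat.eq_zero_or_pos i with rfl | hi0
    · exact h0 hk1
    · exact h1 i hi0 hi
  refine ⟨f, h, ?_⟩
  rw [← Algebra.map_top, ← parabolic_Iio_self ζ v hζ, parabolic, AlgHom.map_adjoin, subGamma,
    parabolic, Set.image_image]
  congr 1
  exact Set.image_congr fun i hi => h i hi

section Index

variable (ζ v N) in
/-- The family `T_{N-1} ⋯ T_j X_j^p`, indexed by `p` and `j`. -/
noncomputable def descFamily (q : Fin ℓ × Set.Icc 1 N) : CyclotomicHecke ζ v N :=
  descProd (T ζ v N) q.2 N * X ζ v N q.2 ^ (q.1 : ℕ)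

theorem range_descFamily : Set.range (descFamily ζ v N) = descSet ζ v N N := by
  ext z
  constructor
  · rintro ⟨⟨p, j, h1, h2⟩, rfl⟩
    exact ⟨j, p, h1, h2, p.2, rfl⟩
  · rintro ⟨j, p, h1, h2, hp, rfl⟩
    exact ⟨(⟨p, hp⟩, ⟨j, h1, h2⟩), rfl⟩

theorem span_descFamily (hℓ : 0 < ℓ) (hζ : ζ ≠ 0) (hN : 1 ≤ N) :
    Submodule.span (subGamma ζ v N (N - 1)) (Set.range (descFamily ζ v N)) = ⊤ := by
  rw [range_descFamily, eq_top_iff]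
  rintro x -
  obtain ⟨k, rfl⟩ : ∃ k, N = k + 1 := ⟨N - 1, by omega⟩
  refine subGamma_le_span hℓ hζ le_rfl ?_
  rw [subGamma, parabolic_Iio_self ζ v hζ]
  trivial

end Index

theorem card_index : Fintype.card (Fin ℓ × Set.Icc 1 N) = N * ℓ := by
  rw [Fintype.card_prod, Fintype.card_fin, ← Nat.card_eq_fintype_card, Nat.card_coe_set_eq]
  simp [mul_comm]

/-- Since the dimension of `H(Γ_N)` is at least `ℓ N` times that of `H(Γ_{N-1})`, a spanning family
of `ℓ N` elements over the image of `H(Γ_{N-1})` is independent, and `H(Γ_{N-1})` embeds. -/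
theorem finrank_subGamma_and_linearIndependent (hℓ : 0 < ℓ) (hζ : ζ ≠ 0) (hN : 2 ≤ N)
    (g : Fin ℓ × Set.Icc 1 N → CyclotomicHecke ζ v N)
    (hg : Submodule.span (subGamma ζ v N (N - 1)) (Set.range g) = ⊤) :
    Module.finrank ℂ (subGamma ζ v N (N - 1)) =
      Module.finrank ℂ (CyclotomicHecke ζ v (N - 1)) ∧
    LinearIndependent (subGamma ζ v N (N - 1)) g := by
  have hfA := finite (v := v) (N := N - 1) hℓ hζ
  have hfH := finite (v := v) (N := N) hℓ hζ
  have hfK := finite_subGamma (v := v) hℓ hζ (N.sub_le 1)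
  obtain ⟨f, -, hf⟩ := exists_inclusion (v := v) hζ (show 1 ≤ N - 1 by omega) (N.sub_le 1)
  have h1 : Module.finrank ℂ (subGamma ζ v N (N - 1)) ≤
      Module.finrank ℂ (CyclotomicHecke ζ v (N - 1)) := by
    rw [← hf]
    exact LinearMap.finrank_le_finrank_of_surjective (f := f.rangeRestrict.toLinearMap)
      f.rangeRestrict_surjective
  have h2 : N * (Module.finrank ℂ (CyclotomicHecke ζ v (N - 1)) * ℓ) ≤
      Module.finrank ℂ (CyclotomicHecke ζ v N) := by
    obtain ⟨k, rfl⟩ : ∃ k, N = k + 1 := ⟨N - 1, by omega⟩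
    have : Module.Finite ℂ (CyclotomicHecke ζ v k) := hfA
    exact le_finrank ζ hζ v (by omega)
  set K := subGamma ζ v N (N - 1)
  let Φ := (Fintype.linearCombination K g).restrictScalars ℂ
  have hΦ : Function.Surjective Φ := by
    have := Fintype.range_linearCombination K g
    rw [hg, LinearMap.range_eq_top] at this
    exact this
  have h3 : Module.finrank ℂ (Fin ℓ × Set.Icc 1 N → K) = N * (Module.finrank ℂ K * ℓ) := by
    rw [Module.finrank_pi_fintype, Finset.sum_const, Finset.card_univ, card_index, smul_eq_mul]
    ring
  have h4 := LinearMap.finrank_le_finrank_of_surjective hΦ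
  have h5 : Module.finrank ℂ K = Module.finrank ℂ (CyclotomicHecke ζ v (N - 1)) := by
    refine le_antisymm h1 ?_
    have := h2.trans (h4.trans_eq h3)
    exact Nat.le_of_mul_le_mul_right (Nat.le_of_mul_le_mul_left this (by omega)) hℓ
  refine ⟨h5, ?_⟩
  rw [linearIndependent_iff_injective_fintypeLinearCombination]
  have h6 : Module.finrank ℂ (Fin ℓ × Set.Icc 1 N → K) =
      Module.finrank ℂ (CyclotomicHecke ζ v N) := by
    refine le_antisymm ?_ h4
    rw [h3, h5]
    exact h2
  exact (LinearMap.injective_iff_surjective_of_finrank_eq_finrank h6).2 hΦ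

theorem linearIndependent_of_span (hℓ : 0 < ℓ) (hζ : ζ ≠ 0) (hN : 2 ≤ N)
    {g : Fin ℓ × Set.Icc 1 N → CyclotomicHecke ζ v N}
    (hg : Submodule.span (subGamma ζ v N (N - 1)) (Set.range g) = ⊤) :
    LinearIndependent (subGamma ζ v N (N - 1)) g :=
  (finrank_subGamma_and_linearIndependent hℓ hζ hN g hg).2

theorem exists_algEquiv_subGamma (hℓ : 0 < ℓ) (hζ : ζ ≠ 0) (hN : 2 ≤ N) :
    ∃ ι : CyclotomicHecke ζ v (N - 1) ≃ₐ[ℂ] subGamma ζ v N (N - 1),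
      (∀ i, 1 ≤ i → i ≤ N - 1 →
        (ι (X ζ v (N - 1) i) : CyclotomicHecke ζ v N) = X ζ v N i) ∧
      (∀ i, i < N - 1 → (ι (T ζ v (N - 1) i) : CyclotomicHecke ζ v N) = T ζ v N i) := by
  obtain ⟨f, hf, hr⟩ := exists_inclusion (v := v) hζ (show 1 ≤ N - 1 by omega) (N.sub_le 1)
  have hfA := finite (v := v) (N := N - 1) hℓ hζ
  have hfH := finite (v := v) (N := N) hℓ hζ
  have hd := (finrank_subGamma_and_linearIndependent hℓ hζ hN _
    (span_descFamily (v := v) hℓ hζ (by omega))).1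
  rw [← hr] at hd
  have hinj : Function.Injective f.rangeRestrict :=
    (LinearMap.injective_iff_surjective_of_finrank_eq_finrank
      (f := f.rangeRestrict.toLinearMap) hd.symm).2 f.rangeRestrict_surjective
  have hT : ∀ i, i < N - 1 → f (T ζ v (N - 1) i) = T ζ v N i := hf
  refine ⟨(AlgEquiv.ofBijective f.rangeRestrict ⟨hinj, f.rangeRestrict_surjective⟩).trans
    (Subalgebra.equivOfEq _ _ hr), fun i h1 h2 => ?_, fun i hi => hT i hi⟩
  change f (X ζ v (N - 1) i) = X ζ v N i
  induction i, h1 using Nat.le_induction with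
  | base => rw [← T_zero, ← T_zero, hT 0 (by omega)]
  | succ i h1 ih =>
    have e1 := T_mul_X_mul_T ζ v (n := N - 1) (i := i) ⟨h1, h2⟩
    have e2 := T_mul_X_mul_T ζ v (n := N) (i := i) ⟨h1, by omega⟩
    have e3 := congrArg f e1
    rw [map_mul, map_mul, map_smul, ih (by omega), hT i (by omega), e2] at e3
    exact (smul_right_injective _ hζ e3).symm

end CyclotomicHecke

/-! ### Bimodules -/

section Bimodule

variable {H : Type*} [Ring H] [Algebra ℂ H]

/-- A decomposition of a basis decomposes the module, also as a complex vector space. -/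
theorem isInternal_of_linearIndependent {K : Subalgebra ℂ H} {J κ : Type*} [DecidableEq κ]
    {g : J → H} (hg : LinearIndependent K g) (hs : Submodule.span K (Set.range g) = ⊤) (c : J → κ)
    {M : κ → Submodule ℂ H}
    (hM : ∀ o, M o = (Submodule.span K (g '' {j | c j = o})).restrictScalars ℂ) :
    DirectSum.IsInternal M := by
  refine DirectSum.isInternal_submodule_of_iSupIndep_of_iSup_eq_top ?_ ?_
  · intro o
    have h1 : ⨆ o', ⨆ (_ : o' ≠ o), M o' ≤
        (Submodule.span K (g '' {j | c j ≠ o})).restrictScalars ℂ := by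
      refine iSup₂_le fun o' ho' => ?_
      rw [hM]
      refine Submodule.span_mono (R := K) (Set.image_mono ?_)
      rintro j rfl
      exact ho'
    refine Disjoint.mono_right h1 ?_
    rw [hM, Submodule.disjoint_def]
    have h2 : Disjoint {j | c j = o} {j | c j ≠ o} := by
      rw [Set.disjoint_left]
      exact fun j h h' => h' h
    have h3 := Submodule.disjoint_def.1 (hg.disjoint_span_image h2)
    exact fun x hx hx' => h3 x hx hx'
  · rw [eq_top_iff]
    rintro x -
    have hx : x ∈ Submodule.span K (Set.range g) := by rw [hs]; trivial
    induction hx using Submodule.span_induction with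
    | mem x hx =>
      obtain ⟨j, rfl⟩ := hx
      refine Submodule.mem_iSup_of_mem (c j) ?_
      rw [hM]
      exact Submodule.subset_span (R := K) ⟨j, rfl, rfl⟩
    | zero => exact zero_mem _
    | add x y _ _ hx hy => exact add_mem hx hy
    | smul a x hx' hx =>
      clear hx'
      induction hx using Submodule.iSup_induction' with
      | mem o y hy =>
        refine Submodule.mem_iSup_of_mem o ?_
        rw [hM] at hy ⊢
        exact (Submodule.span K _).smul_mem a hy
      | zero => rw [smul_zero]; exact zero_mem _
      | add y z _ _ hy hz => rw [smul_add]; exact add_mem hy hz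

/-- If the left multiplications by `Q'` can be moved through `h`, then generators of `Q` over `Q'`
yield generators of `P h Q` over `P`. -/
theorem bimoduleSpan_eq_span {P Q Q' : Subalgebra ℂ H} {h : H} {G : Set H} (hGQ : G ⊆ Q)
    (hQ : ∀ y ∈ Q, y ∈ Submodule.span Q' G) (hc : ∀ a ∈ Q', ∃ b ∈ P, h * a = b * h) :
    bimoduleSpan P h Q = (Submodule.span P ((h * ·) '' G)).restrictScalars ℂ := by
  have key : ∀ y ∈ Submodule.span Q' G, h * y ∈ Submodule.span P ((h * ·) '' G) := by
    intro y hy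
    induction hy using Submodule.span_induction with
    | mem g hg => exact Submodule.subset_span ⟨g, hg, rfl⟩
    | zero => rw [mul_zero]; exact zero_mem _
    | add y z _ _ hy hz => rw [mul_add]; exact add_mem hy hz
    | smul a y _ hy =>
      obtain ⟨b, hb, hab⟩ := hc a a.2
      rw [Subalgebra.smul_def, smul_eq_mul, ← mul_assoc, hab, mul_assoc]
      exact Subalgebra.mul_mem_span hb hy
  refine le_antisymm (Submodule.span_le.2 ?_) ?_
  · rintro _ ⟨x, hx, y, hy, rfl⟩
    rw [mul_assoc]
    exact Subalgebra.mul_mem_span hx (key y (hQ y hy))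
  · intro z hz
    rw [Submodule.restrictScalars_mem] at hz
    induction hz using Submodule.span_induction with
    | mem g hg =>
      obtain ⟨g, hg, rfl⟩ := hg
      exact Submodule.subset_span ⟨1, one_mem _, g, hGQ hg, by rw [one_mul]⟩
    | zero => exact zero_mem _
    | add y z _ _ hy hz => exact add_mem hy hz
    | smul a y _ hy =>
      rw [Subalgebra.smul_def, smul_eq_mul]
      have h1 : bimoduleSpan P h Q ≤ (bimoduleSpan P h Q).comap (LinearMap.mulLeft ℂ (a : H)) := by
        refine Submodule.span_le.2 ?_
        rintro _ ⟨x, hx, y, hy, rfl⟩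
        exact Submodule.subset_span ⟨a * x, mul_mem a.2 hx, y, hy, by
          simp only [LinearMap.mulLeft_apply, mul_assoc]⟩
      exact h1 hy

theorem bimoduleSpan_mul_left {P Q : Subalgebra ℂ H} {h a b : H} (ha : a ∈ P) (hb : b ∈ P)
    (hab : b * a = 1) : bimoduleSpan P (a * h) Q = bimoduleSpan P h Q := by
  refine le_antisymm (Submodule.span_le.2 ?_) (Submodule.span_le.2 ?_)
  · rintro _ ⟨x, hx, y, hy, rfl⟩
    exact Submodule.subset_span ⟨x * a, mul_mem hx ha, y, hy, by simp only [mul_assoc]⟩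
  · rintro _ ⟨x, hx, y, hy, rfl⟩
    refine Submodule.subset_span ⟨x * b, mul_mem hx hb, y, hy, ?_⟩
    rw [mul_assoc x b, ← mul_assoc b, hab, one_mul]

/-- The map `r ⊗ s ↦ r u s` is an isomorphism of `P ⊗_A Q` onto `P u Q` if elements of `A` pass
through `u`, and if generators `q_i` of the left `A`-module `Q` give elements `u q_i` independent
over `P`. -/
theorem isBimoduleIsoTensor_of_linearIndependent {A : Type*} [Ring A] [Algebra ℂ A]
    {P Q : Subalgebra ℂ H} (f : A →ₐ[ℂ] P) (g : A →ₐ[ℂ] Q) {u : H}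
    (hfg : ∀ a, (f a : H) * u = u * (g a : H)) {J : Type*} [Fintype J] (q : J → Q)
    (hq : ∀ s : Q, ∃ c : J → A, s = ∑ j, g (c j) * q j)
    (hli : LinearIndependent P fun j => u * (q j : H)) :
    IsBimoduleIsoTensor f g (bimoduleSpan P u Q) := by
  let e₀ : P ⊗[ℂ] Q →ₗ[ℂ] H := LinearMap.mul' ℂ H ∘ₗ
    TensorProduct.map (LinearMap.mulRight ℂ u ∘ₗ P.val.toLinearMap) Q.val.toLinearMap
  have he₀ : ∀ r s, e₀ (r ⊗ₜ s) = (r : H) * u * (s : H) := fun r s => rfl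
  have hker : balancedSubmodule f g ≤ LinearMap.ker e₀ := by
    refine Submodule.span_le.2 ?_
    rintro _ ⟨r, a, s, rfl⟩
    rw [SetLike.mem_coe, LinearMap.mem_ker, map_sub, he₀, he₀, sub_eq_zero]
    push_cast
    rw [mul_assoc (r : H), hfg]
    simp only [mul_assoc]
  let e₁ : BalancedTensor f g →ₗ[ℂ] H := (balancedSubmodule f g).liftQ e₀ hker
  have he₁ : ∀ r s, e₁ (BalancedTensor.tmul f g r s) = (r : H) * u * (s : H) := fun r s => rfl
  have hind : ∀ p : BalancedTensor f g → Prop, p 0 → (∀ r s, p (BalancedTensor.tmul f g r s)) →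
      (∀ x y, p x → p y → p (x + y)) → ∀ z, p z := by
    intro p h0 h1 h2 z
    obtain ⟨z, rfl⟩ := (balancedSubmodule f g).mkQ_surjective z
    induction z with
    | zero => rwa [map_zero]
    | add x y hx hy => rw [map_add]; exact h2 _ _ hx hy
    | tmul r s => exact h1 r s
  have hadd_left : ∀ r r' s, BalancedTensor.tmul f g (r + r') s =
      BalancedTensor.tmul f g r s + BalancedTensor.tmul f g r' s := fun r r' s => by
    simp only [BalancedTensor.tmul, TensorProduct.add_tmul, map_add]
  -- every tensor is of the form `∑ r_j ⊗ q_j`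
  have hform : ∀ z : BalancedTensor f g, ∃ r : J → P, z = ∑ j, BalancedTensor.tmul f g (r j) (q j) := by
    refine hind _ ⟨0, ?_⟩ ?_ ?_
    · simp [BalancedTensor.tmul]
    · intro r s
      obtain ⟨c, hc⟩ := hq s
      refine ⟨fun j => r * f (c j), ?_⟩
      simp only [BalancedTensor.tmul_balanced]
      rw [hc]
      simp only [BalancedTensor.tmul, TensorProduct.tmul_sum, map_sum]
    · rintro _ _ ⟨r, rfl⟩ ⟨r', rfl⟩
      exact ⟨r + r', by simp only [Pi.add_apply, hadd_left, Finset.sum_add_distrib]⟩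
  have hinj : Function.Injective e₁ := by
    rw [injective_iff_map_eq_zero]
    intro z hz
    obtain ⟨r, rfl⟩ := hform z
    rw [map_sum] at hz
    have h0 := Fintype.linearIndependent_iff.1 hli r (by
      rw [← hz]
      refine Finset.sum_congr rfl fun j _ => ?_
      rw [he₁, Subalgebra.smul_def, smul_eq_mul, mul_assoc])
    simp [h0, BalancedTensor.tmul]
  have hrange : LinearMap.range e₁ = bimoduleSpan P u Q := by
    refine le_antisymm ?_ (Submodule.span_le.2 ?_)
    · rintro _ ⟨z, rfl⟩
      refine hind (fun z => e₁ z ∈ bimoduleSpan P u Q) ?_ ?_ ?_ z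
      · rw [map_zero]; exact zero_mem _
      · exact fun r s => Submodule.subset_span ⟨r, r.2, s, s.2, he₁ r s⟩
      · intro x y hx hy
        rw [map_add]
        exact add_mem hx hy
    · rintro _ ⟨x, hx, y, hy, rfl⟩
      exact ⟨BalancedTensor.tmul f g ⟨x, hx⟩ ⟨y, hy⟩, rfl⟩
  refine ⟨(LinearEquiv.ofInjective e₁ hinj).trans (LinearEquiv.ofEq _ _ hrange), fun w z => ?_,
    fun w z => ?_⟩
  · change e₁ _ = w * e₁ z
    refine hind (fun z => e₁ (BalancedTensor.leftMul f g w z) = w * e₁ z) ?_ ?_ ?_ z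
    · simp
    · intro r s
      rw [BalancedTensor.leftMul_tmul, he₁, he₁]
      push_cast
      simp only [mul_assoc]
    · intro x y hx hy
      rw [map_add, map_add, map_add, hx, hy, mul_add]
  · change e₁ _ = e₁ z * w
    refine hind (fun z => e₁ (BalancedTensor.rightMul f g w z) = e₁ z * w) ?_ ?_ ?_ z
    · simp
    · intro r s
      rw [BalancedTensor.rightMul_tmul, he₁, he₁]
      push_cast
      simp only [mul_assoc]
    · intro x y hx hy
      rw [map_add, map_add, map_add, hx, hy, add_mul]

/-- The criterion `isBimoduleIsoTensor_of_linearIndependent` when `A` is identified with a subalgebra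
of `Q`. -/
theorem isBimoduleIsoTensor_of_span {P Q K : Subalgebra ℂ H} {A : Type*} [Ring A] [Algebra ℂ A]
    (f : A →ₐ[ℂ] P) (φ : A ≃ₐ[ℂ] K) (hKQ : K ≤ Q) {u : H}
    (hf : ∀ a, (f a : H) * u = u * (φ a : H)) {J : Type*} [Fintype J] {q : J → H}
    (hqQ : ∀ j, q j ∈ Q) (hspan : ∀ y ∈ Q, y ∈ Submodule.span K (Set.range q))
    (hli : LinearIndependent P fun j => u * q j) :
    IsBimoduleIsoTensor f ((Subalgebra.inclusion hKQ).comp φ.toAlgHom) (bimoduleSpan P u Q) := by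
  refine isBimoduleIsoTensor_of_linearIndependent _ _ (fun a => hf a) (fun j => ⟨q j, hqQ j⟩)
    (fun s => ?_) hli
  obtain ⟨c, hc⟩ := (Submodule.mem_span_range_iff_exists_fun K).1 (hspan s s.2)
  refine ⟨fun j => φ.symm (c j), Subtype.ext ?_⟩
  rw [← hc, AddSubmonoidClass.coe_finsetSum]
  refine Finset.sum_congr rfl fun j _ => ?_
  change _ = ((φ (φ.symm (c j)) : K) : H) * q j
  rw [AlgEquiv.apply_symm_apply]
  rfl

theorem isBimoduleIsoTensor_inclusion {P Q K : Subalgebra ℂ H} (hKP : K ≤ P) (hKQ : K ≤ Q) {u : H}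
    (hu : ∀ a ∈ K, Commute u a) {J : Type*} [Fintype J] {q : J → H} (hqQ : ∀ j, q j ∈ Q)
    (hspan : ∀ y ∈ Q, y ∈ Submodule.span K (Set.range q))
    (hli : LinearIndependent P fun j => u * q j) :
    IsBimoduleIsoTensor (Subalgebra.inclusion hKP) (Subalgebra.inclusion hKQ)
      (bimoduleSpan P u Q) :=
  isBimoduleIsoTensor_of_span (Subalgebra.inclusion hKP) AlgEquiv.refl hKQ
    (fun a => (hu a a.2).symm.eq) hqQ hspan hli

end Bimodule

namespace CyclotomicHecke

variable {ζ : ℂ} {ℓ : ℕ} {v : Fin ℓ → ℂ} {N : ℕ}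

theorem T_mem_subGamma {i k : ℕ} (h : i < k) : T ζ v N i ∈ subGamma ζ v N k := T_mem ζ v h

/-! ### The basis of transpositions -/

/-- `T_{j,N}` and `T_{N-1} ⋯ T_j` differ by the factor `T_j ⋯ T_{N-2}`. -/
theorem Ttr_eq {j : ℕ} (hj : j ≤ N) :
    Ttr ζ v N j N = ((List.range' j (N - 1 - j)).map (T ζ v N)).prod *
      descProd (T ζ v N) j N := by
  rcases hj.eq_or_lt with rfl | hj
  · simp [Ttr, transpositionWord, descProd_self]
  obtain ⟨k, rfl⟩ : ∃ k, N = k + 1 := ⟨N - 1, by omega⟩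
  rw [Ttr, transpositionWord, descProd_succ_right (by omega), descProd, List.map_append,
    List.prod_append, Nat.add_sub_cancel, show k + 1 - j = (k - j) + 1 by omega,
    List.range'_concat, List.map_append, List.prod_append, mul_assoc,
    show j + 1 * (k - j) = k by omega]
  simp

/-- A product of the `T_i` with `i ≥ 1` is invertible. -/
theorem exists_inverse_map_prod (hζ : ζ ≠ 0) {K : Subalgebra ℂ (CyclotomicHecke ζ v N)} (l : List ℕ)
    (hl : ∀ i ∈ l, 1 ≤ i ∧ i < N ∧ T ζ v N i ∈ K) :
    (l.map (T ζ v N)).prod ∈ K ∧ ∃ b ∈ K, b * (l.map (T ζ v N)).prod = 1 ∧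
      (l.map (T ζ v N)).prod * b = 1 := by
  induction l with
  | nil => exact ⟨by simp, 1, one_mem _, by simp, by simp⟩
  | cons i l ih =>
    obtain ⟨h1, b, hb, hbl, hbr⟩ := ih fun i hi => hl i (List.mem_cons_of_mem _ hi)
    obtain ⟨hi1, hi2, hi3⟩ := hl i List.mem_cons_self
    have hB := isTypeBHecke_T ζ v (N := N)
    have hinv : heckeInv ζ (T ζ v N) i ∈ K :=
      sub_mem (K.smul_mem hi3 _) (K.smul_mem (one_mem K) _)
    rw [List.map_cons, List.prod_cons]
    refine ⟨mul_mem hi3 h1, b * heckeInv ζ (T ζ v N) i, mul_mem hb hinv, ?_, ?_⟩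
    · rw [mul_assoc, ← mul_assoc _ (T ζ v N i), hB.heckeInv_mul hζ hi1 hi2, one_mul, hbl]
    · rw [mul_assoc, ← mul_assoc _ b, hbr, one_mul, hB.mul_heckeInv hζ hi1 hi2]

theorem exists_basis_Ttr (hℓ : 0 < ℓ) (hζ : ζ ≠ 0) (hN : 2 ≤ N) :
    ∃ b : Module.Basis (Fin ℓ × Set.Icc 1 N) (subGamma ζ v N (N - 1)) (CyclotomicHecke ζ v N),
      ∀ (p : Fin ℓ) (j : Set.Icc 1 N), b (p, j) = Ttr ζ v N j N * X ζ v N j ^ (p : ℕ) := by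
  let g : Fin ℓ × Set.Icc 1 N → CyclotomicHecke ζ v N :=
    fun q => Ttr ζ v N q.2 N * X ζ v N q.2 ^ (q.1 : ℕ)
  have hg : Submodule.span (subGamma ζ v N (N - 1)) (Set.range g) = ⊤ := by
    rw [eq_top_iff, ← span_descFamily hℓ hζ (by omega), Submodule.span_le]
    rintro _ ⟨⟨p, j, h1, h2⟩, rfl⟩
    obtain ⟨-, b, hb, hbl, -⟩ := exists_inverse_map_prod (v := v) (N := N) hζ
      (K := subGamma ζ v N (N - 1)) (List.range' j (N - 1 - j)) fun i hi => by
        rw [List.mem_range'_1] at hi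
        exact ⟨by omega, by omega, T_mem_subGamma (by omega)⟩
    have h3 : descFamily ζ v N (p, ⟨j, h1, h2⟩) = b * g (p, ⟨j, h1, h2⟩) := by
      simp only [g, descFamily, Ttr_eq h2]
      rw [← mul_assoc, ← mul_assoc, hbl, one_mul]
    rw [h3]
    exact Subalgebra.mul_mem_span hb (Submodule.subset_span ⟨_, rfl⟩)
  exact ⟨Module.Basis.mk (linearIndependent_of_span hℓ hζ hN hg) hg.ge,
    fun p j => Module.Basis.mk_apply _ _ _⟩

/-! ### The basis adapted to the bimodule decomposition -/

/-- `T_{N-1} ⋯ T_j X_j^p` is a combination of elements `X_N^a T_{N-1} ⋯ T_i`, `i ≥ j`. -/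
theorem desc_mem_span_X_pow (hζ : ζ ≠ 0) {j : ℕ} (h1 : 1 ≤ j) (h2 : j ≤ N) {p : ℕ} (hp : p < ℓ) :
    descProd (T ζ v N) j N * X ζ v N j ^ p ∈ Submodule.span (subGamma ζ v N (N - 1))
      {z | ∃ i a, j ≤ i ∧ i ≤ N ∧ a < ℓ ∧ z = X ζ v N N ^ a * descProd (T ζ v N) i N} := by
  obtain ⟨d, hd⟩ : ∃ d, N = j + d := ⟨N - j, by omega⟩
  induction d generalizing j p with
  | zero =>
    obtain rfl : N = j := hd
    refine Submodule.subset_span ⟨N, p, le_rfl, le_rfl, hp, ?_⟩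
    rw [descProd_self, one_mul, mul_one]
  | succ d ih =>
    have hB := isTypeBHecke_T ζ v (N := N)
    have ih' := fun {p} (hp : p < ℓ) => ih (j := j + 1) (by omega) (by omega) hp (by omega)
    rw [descProd_succ_left (by omega), mul_assoc, T_mul_X_pow ζ v hζ h1 (by omega), mul_sub,
      ← mul_assoc, mul_smul_comm, Finset.mul_sum]
    refine sub_mem (Subalgebra.span_mul_mem ?_ (ih' hp))
      (Submodule.smul_of_tower_mem _ _ (sum_mem fun a ha => ?_))
    · rintro _ ⟨i, a, hi, hiN, ha, rfl⟩
      rcases hi.eq_or_lt with rfl | hi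
      · rw [mul_assoc, ← descProd_succ_left (by omega)]
        exact Submodule.subset_span ⟨j, a, le_rfl, by omega, ha, rfl⟩
      · have hc : Commute (T ζ v N j) (X ζ v N N ^ a * descProd (T ζ v N) i N) :=
          ((commute_T_X ζ v (by omega) ⟨by omega, le_rfl⟩ (by omega)).pow_right a).mul_right
            (commute_descProd fun l h3 h4 =>
              hB.commute (Or.inl (by omega)) (by omega) (by omega))
        rw [← hc.eq]
        exact Subalgebra.mul_mem_span (T_mem_subGamma (by omega))
          (Submodule.subset_span ⟨i, a, by omega, hiN, ha, rfl⟩)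
    · rw [Finset.mem_range] at ha
      have hc : Commute (X ζ v N j) (descProd (T ζ v N) (j + 1) N) :=
        commute_descProd fun l h3 h4 =>
          (commute_T_X ζ v (by omega) ⟨h1, by omega⟩ (by omega)).symm
      have hX : Commute (X ζ v N j) (X ζ v N (j + 1)) :=
        X_comm ζ v ⟨h1, by omega⟩ ⟨by omega, by omega⟩
      have hm : X ζ v N j ∈ subGamma ζ v N (N - 1) :=
        X_mem_of_T_mem hζ ⟨h1, by omega⟩ fun i hi => T_mem_subGamma (by omega)
      rw [← mul_assoc, ← ((hc.mul_right (hX.pow_right (a + 1))).pow_left (p - 1 - a)).eq]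
      refine Subalgebra.mul_mem_span (pow_mem hm _) (Submodule.span_mono ?_ (ih' (by omega)))
      rintro _ ⟨i, b, hi, hiN, hb, rfl⟩
      exact ⟨i, b, by omega, hiN, hb, rfl⟩

/-- The family consisting of the `T_{N-1} ⋯ T_j X_j^p` for `j ≤ n` and the `X_N^p T_{N-1} ⋯ T_j` for
`j > n`. -/
noncomputable def mixedFamily (ζ : ℂ) {ℓ : ℕ} (v : Fin ℓ → ℂ) (N n : ℕ)
    (q : Fin ℓ × Set.Icc 1 N) : CyclotomicHecke ζ v N :=
  if (q.2 : ℕ) ≤ n then descProd (T ζ v N) q.2 N * X ζ v N q.2 ^ (q.1 : ℕ)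
  else X ζ v N N ^ (q.1 : ℕ) * descProd (T ζ v N) q.2 N

theorem span_mixedFamily (hℓ : 0 < ℓ) (hζ : ζ ≠ 0) (hN : 1 ≤ N) (n : ℕ) :
    Submodule.span (subGamma ζ v N (N - 1)) (Set.range (mixedFamily ζ v N n)) = ⊤ := by
  rw [eq_top_iff, ← span_descFamily hℓ hζ hN, Submodule.span_le]
  rintro _ ⟨⟨p, j, h1, h2⟩, rfl⟩
  by_cases hj : j ≤ n
  · exact Submodule.subset_span ⟨(p, ⟨j, h1, h2⟩), if_pos hj⟩
  · refine Submodule.span_mono ?_ (desc_mem_span_X_pow hζ h1 h2 p.2)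
    rintro _ ⟨i, a, h3, h4, ha, rfl⟩
    exact ⟨(⟨a, ha⟩, ⟨i, by omega, h4⟩), if_neg (by simp only; omega)⟩

theorem linearIndependent_mixedFamily (hℓ : 0 < ℓ) (hζ : ζ ≠ 0) (hN : 2 ≤ N) (n : ℕ) :
    LinearIndependent (subGamma ζ v N (N - 1)) (mixedFamily ζ v N n) :=
  linearIndependent_of_span hℓ hζ hN (span_mixedFamily hℓ hζ (by omega) n)

end CyclotomicHecke

namespace CyclotomicHecke

variable {ζ : ℂ} {ℓ : ℕ} {v : Fin ℓ → ℂ}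

/-! ### Generators of `H(Γ_{n,m})` -/

/-- `H(Γ_{n,m})` is generated, as a left module over the subalgebra `H(Γ_I)` with
`I = {0, …, n+m-1} \ {n-1, n}`, by the elements `T_{n-1} ⋯ T_j X_j^p`. -/
theorem subGammaSym_le_span_descSet (hℓ : 0 < ℓ) (hζ : ζ ≠ 0) {n m : ℕ} (hn : 0 < n)
    {y : CyclotomicHecke ζ v (n + m)} (hy : y ∈ subGammaSym ζ v (n + m) n m) :
    y ∈ Submodule.span (parabolic ζ v (n + m) (Set.Iio (n + m) \ {n - 1, n}))
      (descSet ζ v (n + m) n) := by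
  rw [← one_mul y]
  refine Subalgebra.mul_mem_of_mem_adjoin ?_ (one_mem_span_descSet hℓ hn) hy
  rintro g hg _ ⟨i, ⟨hi, hin⟩, rfl⟩
  rw [Set.mem_Iio] at hi
  have hin : i ≠ n := hin
  have hK : ∀ i, i < n + m → i ≠ n - 1 → i ≠ n →
      T ζ v (n + m) i ∈ parabolic ζ v (n + m) (Set.Iio (n + m) \ {n - 1, n}) :=
    fun i h1 h2 h3 => T_mem ζ v ⟨h1, by rintro (h | h) <;> contradiction⟩
  rcases lt_or_gt_of_ne hin with h | h
  · exact desc_mul_T hζ (by omega) (fun i hi => hK i (by omega) (by omega) (by omega)) hg h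
  · have hg' := hg
    obtain ⟨j, p, h1, h2, hp, rfl⟩ := hg
    have hc : Commute (T ζ v (n + m) i) (descProd (T ζ v (n + m)) j n * X ζ v (n + m) j ^ p) :=
      (commute_descProd fun l h3 h4 =>
        (isTypeBHecke_T ζ v).commute (Or.inr (by omega)) (by omega) (by omega)).mul_right
      ((commute_T_X ζ v (by omega) ⟨h1, by omega⟩ (by omega)).pow_right p)
    rw [← hc.eq]
    exact Subalgebra.mul_mem_span (hK i hi (by omega) (by omega)) (Submodule.subset_span hg')

theorem descSet_subset_subGammaSym (hζ : ζ ≠ 0) {n m : ℕ} :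
    descSet ζ v (n + m) n ⊆ subGammaSym ζ v (n + m) n m := by
  rintro _ ⟨j, p, h1, h2, hp, rfl⟩
  have hT : ∀ i, i < n → T ζ v (n + m) i ∈ subGammaSym ζ v (n + m) n m := fun i hi =>
    T_mem ζ v ⟨show i < n + m by omega, show i ≠ n by omega⟩
  refine mul_mem (list_prod_mem fun x hx => ?_)
    (pow_mem (X_mem_of_T_mem hζ ⟨h1, by omega⟩ fun i hi => hT i (by omega)) p)
  simp only [List.mem_map, List.mem_reverse, List.mem_range'_1] at hx
  obtain ⟨i, hi, rfl⟩ := hx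
  exact hT i (by omega)

variable (ζ v) in
/-- The elements `T_{n+m-1} ⋯ T_j`, `n < j ≤ n + m`. -/
def descSymSet (n m : ℕ) : Set (CyclotomicHecke ζ v (n + m)) :=
  {z | ∃ j, n < j ∧ j ≤ n + m ∧ z = descProd (T ζ v (n + m)) j (n + m)}

/-- `H(Γ_{n,m})` is generated, as a left `H(Γ_{n,m-1})`-module, by the `T_{n+m-1} ⋯ T_j`, `j > n`. -/
theorem subGammaSym_le_span_descSymSet {n m : ℕ} (hm : 0 < m)
    {y : CyclotomicHecke ζ v (n + m)} (hy : y ∈ subGammaSym ζ v (n + m) n m) :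
    y ∈ Submodule.span (subGammaSym ζ v (n + m) n (m - 1)) (descSymSet ζ v n m) := by
  have hB := isTypeBHecke_T ζ v (N := n + m)
  have hmem : ∀ j, n < j → j ≤ n + m → descProd (T ζ v (n + m)) j (n + m) ∈
      Submodule.span (subGammaSym ζ v (n + m) n (m - 1)) (descSymSet ζ v n m) :=
    fun j h1 h2 => Submodule.subset_span ⟨j, h1, h2, rfl⟩
  have hK : ∀ i, i + 1 < n + m → i ≠ n → T ζ v (n + m) i ∈ subGammaSym ζ v (n + m) n (m - 1) :=
    fun i h1 h2 => T_mem ζ v ⟨show i < n + (m - 1) by omega, h2⟩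
  rw [← one_mul y]
  refine Subalgebra.mul_mem_of_mem_adjoin ?_
    (by simpa only [descProd_self] using hmem (n + m) (by omega) le_rfl) hy
  rintro _ ⟨j, h1, h2, rfl⟩ _ ⟨i, ⟨hi, hin⟩, rfl⟩
  rw [Set.mem_Iio] at hi
  have hin : i ≠ n := hin
  rcases lt_trichotomy i j with hij | rfl | hij
  · rcases Nat.eq_or_lt_of_le (Nat.succ_le_of_lt hij) with rfl | hij
    · rw [Nat.succ_eq_add_one, ← descProd_succ_left (by omega)]
      exact hmem i (by omega) (by omega)
    · have hc : Commute (T ζ v (n + m) i) (descProd (T ζ v (n + m)) j (n + m)) :=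
        commute_descProd fun l h3 h4 => hB.commute (Or.inl (by omega)) (by omega) (by omega)
      rw [← hc.eq]
      exact Subalgebra.mul_mem_span (hK i (by omega) hin) (hmem j h1 h2)
  · rw [descProd_succ_left hi, mul_assoc, hB.quad i (by omega) hi, mul_add, mul_smul_comm,
      mul_smul_comm, mul_one, ← descProd_succ_left hi]
    exact add_mem (Submodule.smul_of_tower_mem _ _ (hmem i h1 h2))
      (Submodule.smul_of_tower_mem _ _ (hmem (i + 1) (by omega) (by omega)))
  · rw [hB.descProd_mul (by omega) hij hi le_rfl]
    exact Subalgebra.mul_mem_span (hK _ (by omega) (by omega)) (hmem j h1 h2)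

theorem descSymSet_subset_subGammaSym {n m : ℕ} :
    descSymSet ζ v n m ⊆ subGammaSym ζ v (n + m) n m := by
  rintro _ ⟨j, h1, h2, rfl⟩
  refine list_prod_mem fun x hx => ?_
  simp only [List.mem_map, List.mem_reverse, List.mem_range'_1] at hx
  obtain ⟨i, hi, rfl⟩ := hx
  exact T_mem ζ v ⟨show i < n + m by omega, show i ≠ n by omega⟩

/-! ### The shift isomorphism -/

theorem commute_T_descProd {n m i : ℕ} (hi : i + 1 < n) :
    Commute (T ζ v (n + m) i) (descProd (T ζ v (n + m)) n (n + m)) :=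
  commute_descProd fun l _ h2 =>
    (isTypeBHecke_T ζ v).commute (Or.inl (by omega)) (by omega) (by omega)

theorem descProd_mul_T_succ {n m i : ℕ} (hn : 0 < n) (hi : n ≤ i) (hi' : i + 1 < n + m) :
    descProd (T ζ v (n + m)) n (n + m) * T ζ v (n + m) (i + 1) =
      T ζ v (n + m) i * descProd (T ζ v (n + m)) n (n + m) :=
  (isTypeBHecke_T ζ v).descProd_mul hn (by omega) hi' le_rfl

/-- Conjugation with `T_{n+m-1} ⋯ T_n` maps `H(Γ_{n-1,m})` onto the subalgebra `H(Γ_I)`,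
`I = {0, …, n+m-1} \ {n-1, n}`. -/
theorem exists_shift (hζ : ζ ≠ 0) {n m : ℕ} (hn : 0 < n) (hm : 0 < m) :
    ∃ φ : subGammaSym ζ v (n + m) (n - 1) m ≃ₐ[ℂ]
        parabolic ζ v (n + m) (Set.Iio (n + m) \ {n - 1, n}),
      (∀ (a : subGammaSym ζ v (n + m) (n - 1) m) (b : CyclotomicHecke ζ v (n + m)),
        (a : CyclotomicHecke ζ v (n + m)) * descProd (T ζ v (n + m)) n (n + m) =
          descProd (T ζ v (n + m)) n (n + m) * b ↔
        (φ a : CyclotomicHecke ζ v (n + m)) = b) := by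
  obtain ⟨-, w, -, hw1, hw2⟩ := exists_inverse_map_prod (v := v) (N := n + m) hζ (K := ⊤)
    (List.range' n (n + m - n)).reverse fun i hi => by
      rw [List.mem_reverse, List.mem_range'_1] at hi
      exact ⟨by omega, by omega, trivial⟩
  change w * descProd (T ζ v (n + m)) n (n + m) = 1 at hw1
  change descProd (T ζ v (n + m)) n (n + m) * w = 1 at hw2
  have hT1 := fun i (hi : i + 1 < n) => (commute_T_descProd (ζ := ζ) (v := v) (m := m) hi).eq
  have hT2 := fun i hi hi' => descProd_mul_T_succ (ζ := ζ) (v := v) (m := m) (i := i) hn hi hi'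
  set U := descProd (T ζ v (n + m)) n (n + m) with hU
  let c : CyclotomicHecke ζ v (n + m) ≃ₐ[ℂ] CyclotomicHecke ζ v (n + m) :=
    AlgEquiv.ofAlgHom
      (AlgHom.ofLinearMap (LinearMap.mulRight ℂ U ∘ₗ LinearMap.mulLeft ℂ w) (by simp [hw1])
        fun x y => by
          simp only [LinearMap.comp_apply, LinearMap.mulLeft_apply, LinearMap.mulRight_apply]
          rw [show w * x * U * (w * y * U) = w * x * (U * w) * y * U by noncomm_ring, hw2]
          noncomm_ring)
      (AlgHom.ofLinearMap (LinearMap.mulRight ℂ w ∘ₗ LinearMap.mulLeft ℂ U) (by simp [hw2])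
        fun x y => by
          simp only [LinearMap.comp_apply, LinearMap.mulLeft_apply, LinearMap.mulRight_apply]
          rw [show U * x * w * (U * y * w) = U * x * (w * U) * y * w by noncomm_ring, hw1]
          noncomm_ring)
      (by
        ext x
        change w * (U * x * w) * U = x
        rw [show w * (U * x * w) * U = (w * U) * x * (w * U) by noncomm_ring, hw1]
        noncomm_ring)
      (by
        ext x
        change U * (w * x * U) * w = x
        rw [show U * (w * x * U) * w = (U * w) * x * (U * w) by noncomm_ring, hw2]
        noncomm_ring)
  have hc : ∀ a b, a * U = U * b ↔ c a = b := by
    intro a b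
    change _ ↔ w * a * U = b
    constructor
    · intro h
      rw [mul_assoc, h, ← mul_assoc, hw1, one_mul]
    · rintro rfl
      rw [← mul_assoc, ← mul_assoc, hw2, one_mul]
  have hmap : (subGammaSym ζ v (n + m) (n - 1) m).map c.toAlgHom =
      parabolic ζ v (n + m) (Set.Iio (n + m) \ {n - 1, n}) := by
    rw [subGammaSym, parabolic, AlgHom.map_adjoin, parabolic]
    congr 1
    ext z
    constructor
    · rintro ⟨_, ⟨i, ⟨hi, hin⟩, rfl⟩, rfl⟩
      rw [Set.mem_Iio] at hi
      have hin : i ≠ n - 1 := hin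
      change c _ ∈ _
      rcases lt_or_gt_of_ne hin with h | h
      · rw [(hc _ _).1 (hT1 i (by omega))]
        exact ⟨i, ⟨show i < n + m by omega, by
          rintro (h | h)
          · omega
          · have : i = n := h
            omega⟩, rfl⟩
      · rw [(hc _ _).1 (hT2 i (by omega) (by omega)).symm]
        exact ⟨i + 1, ⟨show i + 1 < n + m by omega, by
          rintro (h | h)
          · omega
          · have : i + 1 = n := h
            omega⟩, rfl⟩
    · rintro ⟨i, ⟨hi, hin⟩, rfl⟩
      rw [Set.mem_Iio] at hi
      have h1 : i ≠ n - 1 := fun h => hin (Or.inl h)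
      have h2 : i ≠ n := fun h => hin (Or.inr h)
      rcases lt_or_gt_of_ne h1 with h | h
      · exact ⟨_, ⟨i, ⟨show i < n - 1 + m by omega, h1⟩, rfl⟩, (hc _ _).1 (hT1 i (by omega))⟩
      · obtain ⟨k, rfl⟩ : ∃ k, i = k + 1 := ⟨i - 1, by omega⟩
        exact ⟨_, ⟨k, ⟨show k < n - 1 + m by omega, show k ≠ n - 1 by omega⟩, rfl⟩,
          (hc _ _).1 (hT2 k (by omega) hi).symm⟩
  exact ⟨(c.subalgebraMap _).trans (Subalgebra.equivOfEq _ _ hmap), fun a b => hc a b⟩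

end CyclotomicHecke

namespace CyclotomicHecke

variable {ζ : ℂ} {ℓ : ℕ} {v : Fin ℓ → ℂ}

/-! ### The bimodules -/

theorem bimoduleSpan_Ttr (hζ : ζ ≠ 0) {n m : ℕ} (hn : 0 < n) (hm : 0 < m) :
    bimoduleSpan (subGamma ζ v (n + m) (n + m - 1)) (Ttr ζ v (n + m) n (n + m))
      (subGammaSym ζ v (n + m) n m) =
    bimoduleSpan (subGamma ζ v (n + m) (n + m - 1)) (descProd (T ζ v (n + m)) n (n + m))
      (subGammaSym ζ v (n + m) n m) := by
  obtain ⟨ha, b, hb, hba, -⟩ := exists_inverse_map_prod (v := v) (N := n + m) hζ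
    (K := subGamma ζ v (n + m) (n + m - 1)) (List.range' n (n + m - 1 - n)) fun i hi => by
      rw [List.mem_range'_1] at hi
      exact ⟨by omega, by omega, T_mem_subGamma (by omega)⟩
  rw [Ttr_eq (by omega), bimoduleSpan_mul_left ha hb hba]

theorem bimoduleSpan_descProd (hℓ : 0 < ℓ) (hζ : ζ ≠ 0) {n m : ℕ} (hn : 0 < n) (hm : 0 < m) :
    bimoduleSpan (subGamma ζ v (n + m) (n + m - 1)) (descProd (T ζ v (n + m)) n (n + m))
      (subGammaSym ζ v (n + m) n m) =
    (Submodule.span (subGamma ζ v (n + m) (n + m - 1))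
      ((descProd (T ζ v (n + m)) n (n + m) * ·) '' descSet ζ v (n + m) n)).restrictScalars ℂ := by
  obtain ⟨φ, hφ⟩ := exists_shift (v := v) hζ hn hm
  refine bimoduleSpan_eq_span (descSet_subset_subGammaSym hζ)
    (fun y hy => subGammaSym_le_span_descSet hℓ hζ hn hy) fun a ha => ?_
  refine ⟨φ.symm ⟨a, ha⟩, subGammaSym_le_subGamma ζ v (by omega) (φ.symm ⟨a, ha⟩).2, ?_⟩
  exact ((hφ _ a).2 (by rw [AlgEquiv.apply_symm_apply])).symm

/-- The elements of `H(Γ_{n,m-1})` commute with `X_{n+m}`. -/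
theorem commute_X_pow_of_mem {n m : ℕ} (hm : 0 < m) {a : CyclotomicHecke ζ v (n + m)}
    (ha : a ∈ subGammaSym ζ v (n + m) n (m - 1)) (p : ℕ) :
    Commute (X ζ v (n + m) (n + m) ^ p) a := by
  refine Algebra.commute_of_mem_adjoin_of_forall_mem_commute ha ?_
  rintro _ ⟨i, ⟨hi, -⟩, rfl⟩
  rw [Set.mem_Iio] at hi
  exact ((commute_T_X ζ v (by omega) ⟨by omega, le_rfl⟩ (by omega)).pow_right p).symm

theorem bimoduleSpan_X_pow {n m : ℕ} (hm : 0 < m) (p : ℕ) :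
    bimoduleSpan (subGamma ζ v (n + m) (n + m - 1)) (X ζ v (n + m) (n + m) ^ p)
      (subGammaSym ζ v (n + m) n m) =
    (Submodule.span (subGamma ζ v (n + m) (n + m - 1))
      ((X ζ v (n + m) (n + m) ^ p * ·) '' descSymSet ζ v n m)).restrictScalars ℂ :=
  bimoduleSpan_eq_span descSymSet_subset_subGammaSym
    (fun _ hy => subGammaSym_le_span_descSymSet hm hy) fun a ha =>
      ⟨a, subGammaSym_le_subGamma ζ v (by omega) ha, (commute_X_pow_of_mem hm ha p).eq⟩

theorem isInternal_bimoduleSpan (hℓ : 0 < ℓ) (hζ : ζ ≠ 0) {n m : ℕ} (hn : 0 < n) (hm : 0 < m) :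
    DirectSum.IsInternal (fun o : Option (Fin ℓ) =>
      bimoduleSpan (subGamma ζ v (n + m) (n + m - 1))
        (o.elim (Ttr ζ v (n + m) n (n + m)) fun p => X ζ v (n + m) (n + m) ^ (p : ℕ))
        (subGammaSym ζ v (n + m) n m)) := by
  refine isInternal_of_linearIndependent (linearIndependent_mixedFamily (v := v) hℓ hζ (by omega) n)
    (span_mixedFamily hℓ hζ (by omega) n)
    (fun q => if (q.2 : ℕ) ≤ n then none else some q.1) fun o => ?_
  cases o with
  | none =>
    rw [Option.elim_none, bimoduleSpan_Ttr hζ hn hm, bimoduleSpan_descProd hℓ hζ hn hm]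
    congr 2
    ext z
    constructor
    · rintro ⟨_, ⟨j, p, h1, h2, hp, rfl⟩, rfl⟩
      refine ⟨(⟨p, hp⟩, ⟨j, h1, by omega⟩), if_pos h2, ?_⟩
      simp only [mixedFamily, if_pos h2]
      rw [← mul_assoc, descProd_mul_descProd h2 (by omega)]
    · rintro ⟨⟨p, j, h1, h2⟩, hj, rfl⟩
      have hj : j ≤ n := by
        by_contra hc
        simp [hc] at hj
      refine ⟨_, ⟨j, p, h1, hj, p.2, rfl⟩, ?_⟩
      simp only [mixedFamily, if_pos hj]
      rw [← mul_assoc, descProd_mul_descProd hj (by omega)]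
  | some p =>
    rw [Option.elim_some, bimoduleSpan_X_pow hm]
    congr 2
    ext z
    constructor
    · rintro ⟨_, ⟨j, h1, h2, rfl⟩, rfl⟩
      have hj : ¬ j ≤ n := by omega
      exact ⟨(p, ⟨j, by omega, h2⟩), if_neg hj, if_neg hj⟩
    · rintro ⟨⟨p', j, h1, h2⟩, hj, rfl⟩
      have hj' : ¬ j ≤ n := by
        intro hc
        simp [not_lt.2 hc] at hj
      obtain rfl : p' = p := by
        simp only [Set.mem_ofPred_eq, if_neg hj', Option.some.injEq] at hj
        exact hj
      exact ⟨_, ⟨j, by omega, h2, rfl⟩, (if_neg hj').symm⟩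

theorem isBimoduleIsoTensor_Ttr (hℓ : 0 < ℓ) (hζ : ζ ≠ 0) {n m : ℕ} (hn : 0 < n) (hm : 0 < m)
    (φ : subGammaSym ζ v (n + m) (n - 1) m ≃ₐ[ℂ]
        parabolic ζ v (n + m) (Set.Iio (n + m) \ {n - 1, n}))
    (hφ : ∀ a : subGammaSym ζ v (n + m) (n - 1) m, (a : CyclotomicHecke ζ v (n + m)) * descProd (T ζ v (n + m)) n (n + m) =
      descProd (T ζ v (n + m)) n (n + m) * (φ a : CyclotomicHecke ζ v (n + m)))
    (h1 : subGammaSym ζ v (n + m) (n - 1) m ≤ subGamma ζ v (n + m) (n + m - 1))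
    (h2 : parabolic ζ v (n + m) (Set.Iio (n + m) \ {n - 1, n}) ≤ subGammaSym ζ v (n + m) n m) :
    IsBimoduleIsoTensor (Subalgebra.inclusion h1) ((Subalgebra.inclusion h2).comp φ.toAlgHom)
      (bimoduleSpan (subGamma ζ v (n + m) (n + m - 1)) (Ttr ζ v (n + m) n (n + m))
        (subGammaSym ζ v (n + m) n m)) := by
  rw [bimoduleSpan_Ttr hζ hn hm]
  let q : Fin ℓ × Set.Icc 1 n → CyclotomicHecke ζ v (n + m) :=
    fun r => descProd (T ζ v (n + m)) r.2 n * X ζ v (n + m) r.2 ^ (r.1 : ℕ)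
  have hq : Set.range q = descSet ζ v (n + m) n := by
    ext z
    constructor
    · rintro ⟨⟨p, j, h1, h2⟩, rfl⟩
      exact ⟨j, p, h1, h2, p.2, rfl⟩
    · rintro ⟨j, p, h1, h2, hp, rfl⟩
      exact ⟨(⟨p, hp⟩, ⟨j, h1, h2⟩), rfl⟩
  have hqQ : ∀ r, q r ∈ subGammaSym ζ v (n + m) n m := fun r =>
    descSet_subset_subGammaSym hζ (hq ▸ Set.mem_range_self r)
  refine isBimoduleIsoTensor_of_span _ φ h2 hφ hqQ (fun s hs => ?_) ?_
  · rw [hq]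
    exact subGammaSym_le_span_descSet hℓ hζ hn hs
  · have hli := (linearIndependent_mixedFamily (v := v) (N := n + m) hℓ hζ (by omega) n).comp
      (fun r : Fin ℓ × Set.Icc 1 n =>
        (r.1, (⟨r.2, r.2.2.1, r.2.2.2.trans (Nat.le_add_right n m)⟩ : Set.Icc 1 (n + m))))
      fun r r' h => by
        simp only [Prod.mk.injEq] at h
        have h3 : (r.2 : ℕ) = r'.2 := congrArg (fun x : Set.Icc 1 (n + m) => (x : ℕ)) h.2
        exact Prod.ext h.1 (Subtype.ext h3)
    convert hli using 1
    funext r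
    simp only [Function.comp_apply, mixedFamily, if_pos r.2.2.2, q]
    rw [← mul_assoc, descProd_mul_descProd r.2.2.2 (by omega)]

theorem isBimoduleIsoTensor_X_pow (hℓ : 0 < ℓ) (hζ : ζ ≠ 0) {n m : ℕ} (hn : 0 < n) (hm : 0 < m)
    (p : Fin ℓ) (h1 : subGammaSym ζ v (n + m) n (m - 1) ≤ subGamma ζ v (n + m) (n + m - 1))
    (h2 : subGammaSym ζ v (n + m) n (m - 1) ≤ subGammaSym ζ v (n + m) n m) :
    IsBimoduleIsoTensor (Subalgebra.inclusion h1) (Subalgebra.inclusion h2)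
      (bimoduleSpan (subGamma ζ v (n + m) (n + m - 1)) (X ζ v (n + m) (n + m) ^ (p : ℕ))
        (subGammaSym ζ v (n + m) n m)) := by
  let q : Set.Ioc n (n + m) → CyclotomicHecke ζ v (n + m) :=
    fun j => descProd (T ζ v (n + m)) j (n + m)
  have hq : Set.range q = descSymSet ζ v n m := by
    ext z
    constructor
    · rintro ⟨⟨j, h1, h2⟩, rfl⟩
      exact ⟨j, h1, h2, rfl⟩
    · rintro ⟨j, h1, h2, rfl⟩
      exact ⟨⟨j, h1, h2⟩, rfl⟩
  have hqQ : ∀ j, q j ∈ subGammaSym ζ v (n + m) n m := fun j =>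
    descSymSet_subset_subGammaSym (hq ▸ Set.mem_range_self j)
  refine isBimoduleIsoTensor_inclusion h1 h2 (fun a ha => commute_X_pow_of_mem hm ha p) hqQ
    (fun s hs => ?_) ?_
  · rw [hq]
    exact subGammaSym_le_span_descSymSet hm hs
  · have hli := (linearIndependent_mixedFamily (v := v) (N := n + m) hℓ hζ (by omega) n).comp
      (fun j : Set.Ioc n (n + m) =>
        (p, (⟨j, (Nat.succ_le_of_lt hn).trans j.2.1.le, j.2.2⟩ : Set.Icc 1 (n + m))))
      fun r r' h => by
        simp only [Prod.mk.injEq] at h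
        have h3 : (r : ℕ) = r' := congrArg (fun x : Set.Icc 1 (n + m) => (x : ℕ)) h.2
        exact Subtype.ext h3
    convert hli using 1
    funext j
    exact (if_neg (not_le.2 j.2.1)).symm

end CyclotomicHecke

open CyclotomicHecke in
theorem mainTheorem11 (ℓ n m : ℕ) (hℓ : 0 < ℓ) (hn : 0 < n) (hm : 0 < m)
    (ζ : ℂ) (hζ : ζ ≠ 0) (v : Fin ℓ → ℂ) (hv : ∀ p, v p ≠ 0) :
    -- the algebra `H(Γ_{n+m-1})` is identified with a parabolic subalgebra of `H(Γ_{n+m})`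
    (∃ ι : CyclotomicHecke ζ v (n + m - 1) ≃ₐ[ℂ] subGamma ζ v (n + m) (n + m - 1),
      (∀ i, 1 ≤ i → i ≤ n + m - 1 →
        (ι (X ζ v (n + m - 1) i) : CyclotomicHecke ζ v (n + m)) = X ζ v (n + m) i) ∧
      (∀ i, i < n + m - 1 →
        (ι (T ζ v (n + m - 1) i) : CyclotomicHecke ζ v (n + m)) = T ζ v (n + m) i)) ∧
    -- (a)
    (∃ b : Module.Basis (Fin ℓ × Set.Icc 1 (n + m)) (subGamma ζ v (n + m) (n + m - 1))
        (CyclotomicHecke ζ v (n + m)),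
      ∀ (p : Fin ℓ) (j : Set.Icc 1 (n + m)),
        b (p, j) = Ttr ζ v (n + m) j (n + m) * X ζ v (n + m) j ^ (p : ℕ)) ∧
    -- (b)
    DirectSum.IsInternal (fun o : Option (Fin ℓ) =>
      bimoduleSpan (subGamma ζ v (n + m) (n + m - 1))
        (o.elim (Ttr ζ v (n + m) n (n + m)) fun p => X ζ v (n + m) (n + m) ^ (p : ℕ))
        (subGammaSym ζ v (n + m) n m)) ∧
    -- the isomorphism `φ`
    (∃ φ : subGammaSym ζ v (n + m) (n - 1) m ≃ₐ[ℂ]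
        parabolic ζ v (n + m) (Set.Iio (n + m) \ {n - 1, n}),
      (∀ i (h1 : 1 ≤ i) (h2 : i < n),
        (φ ⟨X ζ v (n + m) i, X_mem ζ v hζ ⟨h1, by omega⟩ fun k (hk : k < i) =>
          ⟨show k < n - 1 + m by omega, show k ≠ n - 1 by omega⟩⟩ : CyclotomicHecke ζ v (n + m)) =
          X ζ v (n + m) i) ∧
      (∀ i (h : i < n - 1),
        (φ ⟨T ζ v (n + m) i, T_mem ζ v
          ⟨show i < n - 1 + m by omega, show i ≠ n - 1 by omega⟩⟩ : CyclotomicHecke ζ v (n + m)) =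
          T ζ v (n + m) i) ∧
      (∀ i (h1 : n ≤ i) (h2 : i < n + m - 1),
        (φ ⟨T ζ v (n + m) i, T_mem ζ v
          ⟨show i < n - 1 + m by omega, show i ≠ n - 1 by omega⟩⟩ : CyclotomicHecke ζ v (n + m)) =
          T ζ v (n + m) (i + 1)) ∧
      -- (c), first isomorphism
      IsBimoduleIsoTensor
        (Subalgebra.inclusion (subGammaSym_le_subGamma ζ v
          (show n - 1 + m ≤ n + m - 1 by omega)))
        ((Subalgebra.inclusion (parabolic_mono ζ v
          (show Set.Iio (n + m) \ {n - 1, n} ⊆ Set.Iio (n + m) \ {n} from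
            fun _ hi => ⟨hi.1, fun hi' => hi.2 (Or.inr hi')⟩))).comp φ.toAlgHom)
        (bimoduleSpan (subGamma ζ v (n + m) (n + m - 1)) (Ttr ζ v (n + m) n (n + m))
          (subGammaSym ζ v (n + m) n m))) ∧
    -- (c), second isomorphism
    (∀ p : Fin ℓ,
      IsBimoduleIsoTensor
        (Subalgebra.inclusion (subGammaSym_le_subGamma ζ v
          (show n + (m - 1) ≤ n + m - 1 by omega)))
        (Subalgebra.inclusion (subGammaSym_le_subGammaSym ζ v (a := n)
          (show m - 1 ≤ m by omega)))
        (bimoduleSpan (subGamma ζ v (n + m) (n + m - 1)) (X ζ v (n + m) (n + m) ^ (p : ℕ))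
          (subGammaSym ζ v (n + m) n m))) := by
  have hN : 2 ≤ n + m := by omega
  obtain ⟨φ, hφ⟩ := exists_shift (v := v) hζ hn hm
  refine ⟨exists_algEquiv_subGamma hℓ hζ hN, exists_basis_Ttr hℓ hζ hN,
    isInternal_bimoduleSpan hℓ hζ hn hm, ⟨φ, fun i h1 h2 => ?_, fun i h => ?_, fun i h1 h2 => ?_,
      isBimoduleIsoTensor_Ttr hℓ hζ hn hm φ (fun a => (hφ a _).2 rfl) _ _⟩,
    fun p => isBimoduleIsoTensor_X_pow hℓ hζ hn hm p _ _⟩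
  · exact (hφ _ _).1 (commute_descProd fun l h3 h4 =>
      (commute_T_X ζ v (by omega) ⟨h1, by omega⟩ (by omega)).symm).eq
  · exact (hφ _ _).1 (commute_T_descProd (by omega)).eq
  · exact (hφ _ _).1 (descProd_mul_T_succ hn h1 (by omega)).symm
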